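/- All Hilbert spaces are finite-dimensional, all logarithms are to base $2$, $\|X\|_1=\operatorname{tr}\sqrt{X^\dagger X}$, and $\alpha\approx_\epsilon\beta$ means $\|\alpha-\beta\|_1\le\epsilon$. Let $\rho=\rho_{AC_A}$ be a state (density operator) shared by Alice and Charlie and $\tilde\rho=\tilde\rho_{C_BB}$ a state shared by Charlie and Bob; Charlie holds $C=C_AC_B$. **Private states.** A private state with $m$ key bits is a state on $(A_0A')(B_0B')$, with $A_0,B_0$ of dimension $2^m$ and $A',B'$ of arbitrary finite dimension, of the form $$\gamma_m=\frac1{2^m}\sum_{i,j=0}^{2^m-1}|ii\rangle\langle jj|_{A_0B_0}\otimes U^{(i)}\sigma_{A'B'}U^{(j)\dagger},$$ where $\sigma_{A'B'}$ is a state and the $U^{(i)}$ are unitaries on $A'B'$. **Key repeater rates.** Define $$K_{A\leftrightarrow C\leftrightarrow B}(\rho\otimes\tilde\rho)=\inf_{\epsilon>0}\limsup_{n\to\infty}\sup_{\Lambda_n,\gamma_m}\Big\{\frac mn:\operatorname{tr}_C\Lambda_n\big((\rho\otimes\tilde\rho)^{\otimes n}\big)\approx_\epsilon\gamma_m\Big\},$$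 where $\Lambda_n$ ranges over the operations among Alice, Charlie and Bob that are implementable by finitely many rounds of local operations and classical communication (LOCC), $\operatorname{tr}_C$ is the partial trace over Charlie's output system, and $\gamma_m$ ranges over the private states between Alice and Bob with $m$ key bits, for any $m\ge 0$. $K_{A\leftarrow C\rightarrow B}(\rho\otimes\tilde\rho)$ is defined in the same way with $\Lambda_n$ restricted to protocols in which all communication is one-way from Charlie: Charlie performs a local operation and sends its outcome to Alice and to Bob, who then apply local operations depending on it. **Restricted relative entropy distances.** Let $\mathrm{SEP}(A:C_A:C_B:B)$ be the set of convex combinations of product states $a_A\otimes c_{C_A}\otimes c'_{C_B}\otimes b_B$. For a POVM $M=\{M_x\}$ with finitely many outcomes let $M(\tau)$ be the probability distribution $x\mapsto\operatorname{tr}M_x\tau$, and for probability distributions let $D(p\|q)=\sum_xp_x\log(p_x/q_x)$, which is $+\infty$ if $p_x>0=q_x$ for some $x$. For a state $\tau$ on $AC_AC_BB$ define $$D_{C\leftrightarrow AB}(\tau)=\inf_{\sigma\in\mathrm{SEP}(A:C_A:C_B:B)}\ \sup_{M\in\mathrm{LOCC}(C:AB)}D(M(\tau)\|M(\sigma)),$$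 $$D_{C\rightarrow AB}(\tau)=\inf_{\sigma\in\mathrm{SEP}(A:C_A:C_B:B)}\ \sup_{M\in\mathrm{LOCC}(C\rightarrow AB)}D(M(\tau)\|M(\sigma)),$$ where $\mathrm{LOCC}(C:AB)$ is the set of POVMs implementable by finitely many rounds of LOCC between $C$ and the joint system $AB$, and $\mathrm{LOCC}(C\rightarrow AB)$ is the set of POVMs implementable by a measurement of $C$ whose outcome is sent to $AB$, followed by a measurement of $AB$ depending on it. The regularisations are $$D^\infty_{\bullet}(\rho\otimes\tilde\rho)=\liminf_{n\to\infty}\frac1nD_{\bullet}\big((\rho\otimes\tilde\rho)^{\otimes n}\big),\qquad \bullet\in\{C\leftrightarrow AB,\ C\rightarrow AB\},$$ where $D_\bullet$ on $n$ copies refers to the parties $A^n,C_A^n,C_B^n,B^n$ (the lower limit is the limit whenever the limit exists). **Theorem.** For all states $\rho_{AC_A}$ and $\tilde\rho_{C_BB}$, $$K_{A\leftrightarrow C\leftrightarrow B}(\rho\otimes\tilde\rho)\le D^\infty_{C\leftrightarrow AB}(\rho\otimes\tilde\rho)\qquad\text{and}\qquad K_{A\leftarrow C\rightarrow B}(\rho\otimes\tilde\rho)\le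 D^\infty_{C\rightarrow AB}(\rho\otimes\tilde\rho).$$ -/

import Mathlib

open scoped Kronecker ENNReal ComplexOrder
open Matrix Filter

namespace KeyRepeater

/-! Finite-dimensional quantum systems are represented by finite index types (an orthonormal basis),
operators by complex matrices.  All systems shared by Charlie, Alice and Bob are ordered as
`C × A × B = C × (A × B)`, so that the cut `C : AB` is the outermost product. -/

section Basic

/-- Density operators: positive semidefinite matrices of trace one. -/
def IsState {S : Type} [Fintype S] (ρ : Matrix S S ℂ) : Prop :=
  ρ.PosSemidef ∧ ρ.trace = 1

/-- Positive operator valued measures with finite outcome set `X`. -/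
def IsPOVM {S X : Type} [Fintype S] [DecidableEq S] [Fintype X]
    (E : X → Matrix S S ℂ) : Prop :=
  (∀ x, (E x).PosSemidef) ∧ ∑ x, E x = 1

/-- A complete family of Kraus operators from the system `S` to the system `T`.  It describes the
quantum operation with outcomes `i : I` that maps `ρ` to `K i * ρ * (K i)ᴴ` on outcome `i`
(an instrument), or, if the outcome is forgotten, the completely positive trace preserving map
`ρ ↦ ∑ i, K i * ρ * (K i)ᴴ`. -/
def IsKraus {S T I : Type} [DecidableEq S] [Fintype T] [Fintype I]
    (K : I → Matrix T S ℂ) : Prop :=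
  ∑ i, (K i)ᴴ * K i = 1

/-- The trace norm: the sum of the singular values (the square roots of the eigenvalues of `Xᴴ X`). -/
noncomputable def traceNorm {S : Type} [Fintype S] [DecidableEq S] (X : Matrix S S ℂ) : ℝ :=
  ∑ s, Real.sqrt ((isHermitian_conjTranspose_mul_self X).eigenvalues s)

/-- The partial trace over the first tensor factor. -/
def traceFst {C S : Type} [Fintype C] (X : Matrix (C × S) (C × S) ℂ) : Matrix S S ℂ :=
  Matrix.of fun s t => ∑ c, X (c, s) (c, t)

open Classical in
/-- The relative entropy `D(p‖q)`, in bits, of two probability distributions on a finite set. -/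
noncomputable def relEntropy {X : Type} [Fintype X] (p q : X → ℝ) : ℝ≥0∞ :=
  if ∀ x, q x = 0 → p x = 0 then
    ENNReal.ofReal (∑ x, p x * Real.logb 2 (p x / q x))
  else ⊤

/-- The outcome distribution `x ↦ tr (E x ρ)` of the measurement `E` on the state `ρ`. -/
noncomputable def outcomeDist {S X : Type} [Fintype S]
    (E : X → Matrix S S ℂ) (ρ : Matrix S S ℂ) : X → ℝ :=
  fun x => (E x * ρ).trace.re

end Basic

section States

variable {A CA CB B : Type}

/-- The state `ρ_{A C_A} ⊗ ρ'_{C_B B}`, with its systems put into the order `(C_A C_B) A B`. -/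
def joint (ρ : Matrix (A × CA) (A × CA) ℂ) (ρ' : Matrix (CB × B) (CB × B) ℂ) :
    Matrix ((CA × CB) × A × B) ((CA × CB) × A × B) ℂ :=
  Matrix.of fun x y =>
    ρ (x.2.1, x.1.1) (y.2.1, y.1.1) * ρ' (x.1.2, x.2.2) (y.1.2, y.2.2)

/-- The `n`-fold tensor power of an operator on `(C_A C_B) A B`, as an operator on
`(C_A^n C_B^n) A^n B^n`. -/
def copies (τ : Matrix ((CA × CB) × A × B) ((CA × CB) × A × B) ℂ) (n : ℕ) :
    Matrix (((Fin n → CA) × (Fin n → CB)) × (Fin n → A) × (Fin n → B))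
      (((Fin n → CA) × (Fin n → CB)) × (Fin n → A) × (Fin n → B)) ℂ :=
  Matrix.of fun x y => ∏ i,
    τ ((x.1.1 i, x.1.2 i), x.2.1 i, x.2.2 i) ((y.1.1 i, y.1.2 i), y.2.1 i, y.2.2 i)

/-- The fully separable states `SEP(A : C_A : C_B : B)`: convex combinations of product states. -/
def SEP (A CA CB B : Type) [Fintype A] [Fintype CA] [Fintype CB] [Fintype B] :
    Set (Matrix ((CA × CB) × A × B) ((CA × CB) × A × B) ℂ) :=
  convexHull ℝ {σ | ∃ (a : Matrix A A ℂ) (c : Matrix CA CA ℂ) (c' : Matrix CB CB ℂ)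
    (b : Matrix B B ℂ), IsState a ∧ IsState c ∧ IsState c' ∧ IsState b ∧
      σ = (c ⊗ₖ c') ⊗ₖ (a ⊗ₖ b)}

/-- Private states `γ_m` with `m` key bits: Alice holds a key system of dimension `2 ^ m` and a
shield `A'`, Bob a key system of dimension `2 ^ m` and a shield `B'`, and
`γ_m = 2^{-m} ∑_{i j} |ii⟩⟨jj| ⊗ U_i σ U_jᴴ` for a state `σ` of `A' B'` and unitaries `U_i` of
`A' B'`: a maximally entangled state tensored with `σ`, twisted by the controlled unitary. -/
def IsPrivateState (m : ℕ) {A' B' : Type} [Fintype A'] [DecidableEq A'] [Fintype B'] [DecidableEq B']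
    (γ : Matrix ((Fin (2 ^ m) × A') × (Fin (2 ^ m) × B'))
      ((Fin (2 ^ m) × A') × (Fin (2 ^ m) × B')) ℂ) : Prop :=
  ∃ (U : Fin (2 ^ m) → Matrix (A' × B') (A' × B') ℂ) (σ : Matrix (A' × B') (A' × B') ℂ),
    (∀ i, U i ∈ Matrix.unitaryGroup (A' × B') ℂ) ∧ IsState σ ∧
    γ = Matrix.of fun x y =>
      if x.1.1 = x.2.1 ∧ y.1.1 = y.2.1 then
        (1 / 2 ^ m : ℂ) * (U x.1.1 * σ * (U y.1.1)ᴴ) (x.1.2, x.2.2) (y.1.2, y.2.2)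
      else 0

end States

section Operations

/-- Completely positive trace preserving maps from the tripartite system `C A B` to `C' A' B'` that
are implementable by local operations and (two-way) classical communication in finitely many
rounds.  In a round one party performs a local quantum operation, with arbitrary output system, and
broadcasts its outcome `i`; the remaining protocol `Λ i` may depend on it.  Taking one Kraus
operator per outcome means that every outcome is announced; unannounced outcomes are those that
`Λ i` ignores. -/
inductive IsLOCC {C' A' B' : Type} [Fintype C'] [DecidableEq C'] [Fintype A'] [DecidableEq A']
    [Fintype B'] [DecidableEq B'] :
    ∀ {C A B : Type} [Fintype C] [DecidableEq C] [Fintype A] [DecidableEq A]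
      [Fintype B] [DecidableEq B],
      (Matrix (C × A × B) (C × A × B) ℂ → Matrix (C' × A' × B') (C' × A' × B') ℂ) → Prop
  | done : IsLOCC (fun ρ : Matrix (C' × A' × B') (C' × A' × B') ℂ => ρ)
  | charlie {C C₁ A B I : Type} [Fintype C] [DecidableEq C] [Fintype A] [DecidableEq A]
      [Fintype B] [DecidableEq B] [Fintype C₁] [DecidableEq C₁] [Fintype I]
      (K : I → Matrix C₁ C ℂ) (_ : IsKraus K)
      (Λ : I → Matrix (C₁ × A × B) (C₁ × A × B) ℂ → Matrix (C' × A' × B') (C' × A' × B') ℂ)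
      (_ : ∀ i, IsLOCC (Λ i)) :
      IsLOCC (fun ρ : Matrix (C × A × B) (C × A × B) ℂ =>
        ∑ i, Λ i ((K i ⊗ₖ (1 : Matrix (A × B) (A × B) ℂ)) * ρ *
          (K i ⊗ₖ (1 : Matrix (A × B) (A × B) ℂ))ᴴ))
  | alice {C A A₁ B I : Type} [Fintype C] [DecidableEq C] [Fintype A] [DecidableEq A]
      [Fintype B] [DecidableEq B] [Fintype A₁] [DecidableEq A₁] [Fintype I]
      (K : I → Matrix A₁ A ℂ) (_ : IsKraus K)
      (Λ : I → Matrix (C × A₁ × B) (C × A₁ × B) ℂ → Matrix (C' × A' × B') (C' × A' × B') ℂ)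
      (_ : ∀ i, IsLOCC (Λ i)) :
      IsLOCC (fun ρ : Matrix (C × A × B) (C × A × B) ℂ =>
        ∑ i, Λ i (((1 : Matrix C C ℂ) ⊗ₖ (K i ⊗ₖ (1 : Matrix B B ℂ))) * ρ *
          ((1 : Matrix C C ℂ) ⊗ₖ (K i ⊗ₖ (1 : Matrix B B ℂ)))ᴴ))
  | bob {C A B B₁ I : Type} [Fintype C] [DecidableEq C] [Fintype A] [DecidableEq A]
      [Fintype B] [DecidableEq B] [Fintype B₁] [DecidableEq B₁] [Fintype I]
      (K : I → Matrix B₁ B ℂ) (_ : IsKraus K)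
      (Λ : I → Matrix (C × A × B₁) (C × A × B₁) ℂ → Matrix (C' × A' × B') (C' × A' × B') ℂ)
      (_ : ∀ i, IsLOCC (Λ i)) :
      IsLOCC (fun ρ : Matrix (C × A × B) (C × A × B) ℂ =>
        ∑ i, Λ i (((1 : Matrix C C ℂ) ⊗ₖ ((1 : Matrix A A ℂ) ⊗ₖ K i)) * ρ *
          ((1 : Matrix C C ℂ) ⊗ₖ ((1 : Matrix A A ℂ) ⊗ₖ K i))ᴴ))

/-- Tripartite operations in which all communication is one-way from Charlie: Charlie performs a
local operation and sends its outcome `i` to Alice and to Bob, who then apply local completely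
positive trace preserving maps (with Kraus operators `S i j` and `T i l`) that depend on `i`. -/
def IsOneWayLOCC {C A B C' A' B' : Type} [Fintype C] [DecidableEq C] [Fintype A] [DecidableEq A]
    [Fintype B] [DecidableEq B] [Fintype C'] [Fintype A'] [Fintype B']
    (Λ : Matrix (C × A × B) (C × A × B) ℂ → Matrix (C' × A' × B') (C' × A' × B') ℂ) : Prop :=
  ∃ (I J L : Type) (_ : Fintype I) (_ : Fintype J) (_ : Fintype L)
    (K : I → Matrix C' C ℂ) (S : I → J → Matrix A' A ℂ) (T : I → L → Matrix B' B ℂ),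
    IsKraus K ∧ (∀ i, IsKraus (S i)) ∧ (∀ i, IsKraus (T i)) ∧
    Λ = fun ρ => ∑ i, ∑ j, ∑ l,
      (K i ⊗ₖ (S i j ⊗ₖ T i l)) * ρ * (K i ⊗ₖ (S i j ⊗ₖ T i l))ᴴ

/-- Measurements (POVMs with outcome set `X`) of a bipartite system `C D` that are implementable by
local operations and (two-way) classical communication in finitely many rounds.  When the
protocol stops it announces a result `x : X`; before that, in each round one party performs a
local quantum operation and sends its outcome `i` to the other, and the remaining measurement `E i`
may depend on it. -/
inductive IsLOCCMeasurement {X : Type} [DecidableEq X] :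
    ∀ {C D : Type} [Fintype C] [DecidableEq C] [Fintype D] [DecidableEq D],
      (X → Matrix (C × D) (C × D) ℂ) → Prop
  | announce {C D : Type} [Fintype C] [DecidableEq C] [Fintype D] [DecidableEq D] (x₀ : X) :
      IsLOCCMeasurement (fun x => if x = x₀ then (1 : Matrix (C × D) (C × D) ℂ) else 0)
  | left {C C₁ D I : Type} [Fintype C] [DecidableEq C] [Fintype D] [DecidableEq D]
      [Fintype C₁] [DecidableEq C₁] [Fintype I]
      (K : I → Matrix C₁ C ℂ) (_ : IsKraus K)
      (E : I → X → Matrix (C₁ × D) (C₁ × D) ℂ) (_ : ∀ i, IsLOCCMeasurement (E i)) :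
      IsLOCCMeasurement (fun x => ∑ i, (K i ⊗ₖ (1 : Matrix D D ℂ))ᴴ * E i x *
        (K i ⊗ₖ (1 : Matrix D D ℂ)))
  | right {C D D₁ I : Type} [Fintype C] [DecidableEq C] [Fintype D] [DecidableEq D]
      [Fintype D₁] [DecidableEq D₁] [Fintype I]
      (K : I → Matrix D₁ D ℂ) (_ : IsKraus K)
      (E : I → X → Matrix (C × D₁) (C × D₁) ℂ) (_ : ∀ i, IsLOCCMeasurement (E i)) :
      IsLOCCMeasurement (fun x => ∑ i, ((1 : Matrix C C ℂ) ⊗ₖ K i)ᴴ * E i x *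
        ((1 : Matrix C C ℂ) ⊗ₖ K i))

/-- Measurements of a bipartite system `C D` with one-way communication `C → D`: the outcome `i` of
a measurement `P` of `C` is sent to `D`, where the measurement `N i` gives the final result. -/
def IsOneWayLOCCMeasurement {X C D : Type} [Fintype X] [Fintype C] [DecidableEq C]
    [Fintype D] [DecidableEq D] (E : X → Matrix (C × D) (C × D) ℂ) : Prop :=
  ∃ (I : Type) (_ : Fintype I) (P : I → Matrix C C ℂ) (N : I → X → Matrix D D ℂ),
    IsPOVM P ∧ (∀ i, IsPOVM (N i)) ∧ E = fun x => ∑ i, P i ⊗ₖ N i x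

end Operations

section Quantities

variable {A CA CB B : Type} [Fintype A] [DecidableEq A] [Fintype CA] [DecidableEq CA]
  [Fintype CB] [DecidableEq CB] [Fintype B] [DecidableEq B]

/-- Some LOCC operation among Alice, Charlie and Bob transforms `τ`, after Charlie's system has been
traced out, into a state that is `ε`-close to a private state with `m` key bits. -/
def YieldsKey {A CA CB B : Type} [Fintype A] [DecidableEq A] [Fintype CA] [DecidableEq CA]
    [Fintype CB] [DecidableEq CB] [Fintype B] [DecidableEq B]
    (τ : Matrix ((CA × CB) × A × B) ((CA × CB) × A × B) ℂ) (ε : ℝ) (m : ℕ) : Prop :=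
  ∃ (C' A' B' : Type) (_ : Fintype C') (_ : DecidableEq C') (_ : Fintype A') (_ : DecidableEq A')
    (_ : Fintype B') (_ : DecidableEq B')
    (Λ : Matrix ((CA × CB) × A × B) ((CA × CB) × A × B) ℂ →
      Matrix (C' × (Fin (2 ^ m) × A') × (Fin (2 ^ m) × B'))
        (C' × (Fin (2 ^ m) × A') × (Fin (2 ^ m) × B')) ℂ)
    (γ : Matrix ((Fin (2 ^ m) × A') × (Fin (2 ^ m) × B'))
        ((Fin (2 ^ m) × A') × (Fin (2 ^ m) × B')) ℂ),
    IsLOCC Λ ∧ IsPrivateState m γ ∧ traceNorm (traceFst (Λ τ) - γ) ≤ ε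

/-- As `YieldsKey`, with all communication one-way from Charlie. -/
def YieldsKeyOneWay {A CA CB B : Type} [Fintype A] [DecidableEq A] [Fintype CA] [DecidableEq CA]
    [Fintype CB] [DecidableEq CB] [Fintype B] [DecidableEq B]
    (τ : Matrix ((CA × CB) × A × B) ((CA × CB) × A × B) ℂ) (ε : ℝ) (m : ℕ) : Prop :=
  ∃ (C' A' B' : Type) (_ : Fintype C') (_ : DecidableEq C') (_ : Fintype A') (_ : DecidableEq A')
    (_ : Fintype B') (_ : DecidableEq B')
    (Λ : Matrix ((CA × CB) × A × B) ((CA × CB) × A × B) ℂ →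
      Matrix (C' × (Fin (2 ^ m) × A') × (Fin (2 ^ m) × B'))
        (C' × (Fin (2 ^ m) × A') × (Fin (2 ^ m) × B')) ℂ)
    (γ : Matrix ((Fin (2 ^ m) × A') × (Fin (2 ^ m) × B'))
        ((Fin (2 ^ m) × A') × (Fin (2 ^ m) × B')) ℂ),
    IsOneWayLOCC Λ ∧ IsPrivateState m γ ∧ traceNorm (traceFst (Λ τ) - γ) ≤ ε

/-- The quantum key repeater rate `K_{A ↔ C ↔ B}`. -/
noncomputable def keyRate (τ : Matrix ((CA × CB) × A × B) ((CA × CB) × A × B) ℂ) : ℝ≥0∞ :=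
  ⨅ (ε : ℝ) (_ : 0 < ε), limsup
    (fun n : ℕ => ⨆ (m : ℕ) (_ : YieldsKey (copies τ n) ε m), (m : ℝ≥0∞) / (n : ℝ≥0∞)) atTop

/-- The one-way quantum key repeater rate `K_{A ← C → B}`. -/
noncomputable def keyRateOneWay (τ : Matrix ((CA × CB) × A × B) ((CA × CB) × A × B) ℂ) : ℝ≥0∞ :=
  ⨅ (ε : ℝ) (_ : 0 < ε), limsup
    (fun n : ℕ => ⨆ (m : ℕ) (_ : YieldsKeyOneWay (copies τ n) ε m), (m : ℝ≥0∞) / (n : ℝ≥0∞)) atTop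

/-- The LOCC-restricted relative entropy distance `D_{C ↔ AB}` to the fully separable states. -/
noncomputable def loccDist {A CA CB B : Type} [Fintype A] [DecidableEq A] [Fintype CA]
    [DecidableEq CA] [Fintype CB] [DecidableEq CB] [Fintype B] [DecidableEq B]
    (τ : Matrix ((CA × CB) × A × B) ((CA × CB) × A × B) ℂ) : ℝ≥0∞ :=
  ⨅ σ ∈ SEP A CA CB B,
    ⨆ (X : Type) (_ : Fintype X) (_ : DecidableEq X)
      (E : X → Matrix ((CA × CB) × A × B) ((CA × CB) × A × B) ℂ) (_ : IsLOCCMeasurement E),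
      relEntropy (outcomeDist E τ) (outcomeDist E σ)

/-- The distance `D_{C → AB}` to the fully separable states, restricted to measurements with one-way
communication from Charlie. -/
noncomputable def loccDistOneWay {A CA CB B : Type} [Fintype A] [DecidableEq A] [Fintype CA]
    [DecidableEq CA] [Fintype CB] [DecidableEq CB] [Fintype B] [DecidableEq B]
    (τ : Matrix ((CA × CB) × A × B) ((CA × CB) × A × B) ℂ) : ℝ≥0∞ :=
  ⨅ σ ∈ SEP A CA CB B,
    ⨆ (X : Type) (_ : Fintype X)
      (E : X → Matrix ((CA × CB) × A × B) ((CA × CB) × A × B) ℂ) (_ : IsOneWayLOCCMeasurement E),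
      relEntropy (outcomeDist E τ) (outcomeDist E σ)

/-- The regularisation `D^∞_{C ↔ AB}`.  The lower limit is the limit whenever the limit exists. -/
noncomputable def regLoccDist (τ : Matrix ((CA × CB) × A × B) ((CA × CB) × A × B) ℂ) : ℝ≥0∞ :=
  liminf (fun n : ℕ => loccDist (copies τ n) / (n : ℝ≥0∞)) atTop

/-- The regularisation `D^∞_{C → AB}`.  The lower limit is the limit whenever the limit exists. -/
noncomputable def regLoccDistOneWay
    (τ : Matrix ((CA × CB) × A × B) ((CA × CB) × A × B) ℂ) : ℝ≥0∞ :=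
  liminf (fun n : ℕ => loccDistOneWay (copies τ n) / (n : ℝ≥0∞)) atTop

end Quantities

end KeyRepeater

set_option linter.unusedSectionVars false

/-! A protocol that distils key gives a measurement that tells the input from separable states. If
`Λ` turns `n` copies into a state `ε`-close to a private state `γ = W σ Wᴴ`, with `W = 2^{-m/2} ∑ᵢ
|ii⟩ ⊗ Uᵢ`, run `Λ`, discard Charlie's output and measure `{T, 1 - T}` with `T = W Wᴴ`. Once Alice
and Bob count as one party this is an allowed measurement of `C : AB`. The copies pass with
probability at least `1 - ε`, separable states with probability at most `2^{-m}`, so the relative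
entropy of the outcomes is at least `(1 - ε) m - 1`.

The regularisation is a lower limit over all numbers `N` of copies, so the test is repeated on about
`N / n` blocks. A separable state of all `N` copies may be correlated between blocks, hence the
bound `2^{-m}` must multiply: if a positive `R` on the other blocks has expectation at most `s` in
product states, then `T ⊗ R` must have expectation at most `s / 2^m` in states that are product
between Charlie, Alice and Bob but entangled across blocks. This is
`SepBound.sepBoundWith_privacyTest`. It is transported through `Λ` because the Kraus operators of
LOCC are products (`SepBoundWith.kraus`, `Implements.kraus`), and iterated in
`Certificate.kronecker` and `KeyTest.certificate_copies`. Only separability between Charlie, Alice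
and Bob is exploited, not that between `C_A` and `C_B`.

This gives `D (n q + r) ≥ q ((1 - ε) m - 1)` for all `q` and `r`, hence `m / n ≤ (1 - ε)⁻¹ (D^∞ + 1
/ n)`. Letting `n → ∞` and then `ε → 0` ends the proof. -/

namespace KeyRepeater

/-! ### Hilbert–Schmidt norm, Kraus families and trace norm. -/

section MatrixFacts

variable {S S₂ T : Type} [Fintype S] [Fintype S₂] [Fintype T]

open scoped MatrixOrder in
theorem exists_eq_conjTranspose_mul_self {M : Matrix S S ℂ} (hM : M.PosSemidef) :
    ∃ Y : Matrix S S ℂ, M = Yᴴ * Y := by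
  classical
  obtain ⟨Y, hY⟩ := CStarAlgebra.nonneg_iff_eq_star_mul_self.mp hM.nonneg
  exact ⟨Y, hY⟩

theorem trace_mul_nonneg {M N : Matrix S S ℂ} (hM : M.PosSemidef) (hN : N.PosSemidef) :
    0 ≤ (M * N).trace := by
  obtain ⟨Y, rfl⟩ := exists_eq_conjTranspose_mul_self hN
  rw [← Matrix.mul_assoc, Matrix.trace_mul_comm, ← Matrix.mul_assoc]
  exact (hM.mul_mul_conjTranspose_same Y).trace_nonneg

/-- The squared Hilbert–Schmidt norm. -/
noncomputable def hsSq (X : Matrix S S₂ ℂ) : ℝ := (Xᴴ * X).trace.re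

theorem hsSq_eq_sum (X : Matrix S S₂ ℂ) : hsSq X = ∑ i, ∑ j, ‖X i j‖ ^ 2 := by
  rw [hsSq, Finset.sum_comm]
  simp only [Matrix.trace, Matrix.diag, Matrix.mul_apply, conjTranspose_apply, Complex.re_sum]
  refine Finset.sum_congr rfl fun j _ => Finset.sum_congr rfl fun i _ => ?_
  rw [← Complex.normSq_eq_norm_sq, RCLike.star_def, ← Complex.normSq_eq_conj_mul_self,
    Complex.ofReal_re]

theorem hsSq_nonneg (X : Matrix S S₂ ℂ) : 0 ≤ hsSq X := by
  rw [hsSq_eq_sum]; positivity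

theorem ofReal_hsSq (X : Matrix S S₂ ℂ) : ((hsSq X : ℝ) : ℂ) = (Xᴴ * X).trace :=
  (Complex.eq_re_of_ofReal_le (r := 0)
    (by simpa using (posSemidef_conjTranspose_mul_self X).trace_nonneg)).symm

theorem hsSq_smul (z : ℂ) (X : Matrix S S₂ ℂ) : hsSq (z • X) = ‖z‖ ^ 2 * hsSq X := by
  simp [hsSq_eq_sum, Finset.mul_sum, mul_pow]

theorem hsSq_kraus [DecidableEq S] {I : Type} [Fintype I] {K : I → Matrix T S ℂ}
    (hK : IsKraus K) (X : Matrix S S₂ ℂ) : ∑ i, hsSq (K i * X) = hsSq X := by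
  simp only [hsSq, ← Complex.re_sum, ← Matrix.trace_sum, conjTranspose_mul]
  congr 2
  calc ∑ i, Xᴴ * (K i)ᴴ * (K i * X) = Xᴴ * (∑ i, (K i)ᴴ * K i) * X := by
        simp only [Matrix.mul_sum, Matrix.sum_mul, Matrix.mul_assoc]
    _ = Xᴴ * X := by rw [hK, Matrix.mul_one]

theorem sqrt_hsSq_sum_le {I : Type} [Fintype I] (Z : I → Matrix S S₂ ℂ) :
    √(hsSq (∑ i, Z i)) ≤ ∑ i, √(hsSq (Z i)) := by
  let _ := Matrix.frobeniusNormedAddCommGroup (m := S) (n := S₂) (α := ℂ)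
  have h : ∀ X : Matrix S S₂ ℂ, √(hsSq X) = ‖X‖ := fun X => by
    rw [Matrix.frobenius_norm_def, Real.sqrt_eq_rpow, hsSq_eq_sum]
    norm_cast
  simp only [h]
  exact norm_sum_le _ _

theorem isKraus_kronecker_one {S S₂ T : Type} [Fintype S₂] [Fintype T] [DecidableEq S] [DecidableEq S₂] {I : Type} [Fintype I]
    {K : I → Matrix T S ℂ} (hK : IsKraus K) :
    IsKraus fun i => K i ⊗ₖ (1 : Matrix S₂ S₂ ℂ) := by
  have h := congrArg (fun M => M ⊗ₖ (1 : Matrix S₂ S₂ ℂ)) hK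
  simp only [one_kronecker_one] at h
  rw [IsKraus, ← h]
  ext x y
  simp [conjTranspose_kronecker, ← mul_kronecker_mul, Matrix.sum_apply, Finset.sum_mul]

theorem isKraus_one_kronecker {S S₂ T : Type} [Fintype S₂] [Fintype T] [DecidableEq S] [DecidableEq S₂] {I : Type} [Fintype I]
    {K : I → Matrix T S ℂ} (hK : IsKraus K) :
    IsKraus fun i => (1 : Matrix S₂ S₂ ℂ) ⊗ₖ K i := by
  have h := congrArg (fun M => (1 : Matrix S₂ S₂ ℂ) ⊗ₖ M) hK
  simp only [one_kronecker_one] at h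
  rw [IsKraus, ← h]
  ext x y
  simp [conjTranspose_kronecker, ← mul_kronecker_mul, Matrix.sum_apply, Finset.mul_sum]

theorem isPOVM_of_isKraus [DecidableEq S] {I : Type} [Fintype I] {K : I → Matrix T S ℂ}
    (hK : IsKraus K) : IsPOVM fun i => (K i)ᴴ * K i :=
  ⟨fun i => posSemidef_conjTranspose_mul_self (K i), hK⟩

/-- In an eigenbasis `U` of `Xᴴ X`, the columns of `X U` have the singular values of `X` as norms
and those of `P U` have norm at most one, so Cauchy–Schwarz applies column by column. -/
theorem abs_re_trace_mul_le_traceNorm [DecidableEq S] {P : Matrix S S ℂ} (hP : Pᴴ = P)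
    (hPP : P * P = P) (X : Matrix S S ℂ) : |(P * X).trace.re| ≤ traceNorm X := by
  set hX := isHermitian_conjTranspose_mul_self X
  set U : Matrix S S ℂ := hX.eigenvectorUnitary.1
  have hUU : Uᴴ * U = 1 := Unitary.coe_star_mul_self hX.eigenvectorUnitary
  have hUU' : U * Uᴴ = 1 := Unitary.coe_mul_star_self hX.eigenvectorUnitary
  have hdiag : (X * U)ᴴ * (X * U) = diagonal fun s => (hX.eigenvalues s : ℂ) := by
    have h := hX.conjStarAlgAut_star_eigenvectorUnitary
    rw [Unitary.conjStarAlgAut_apply] at h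
    simp only [Unitary.coe_star, star_star] at h
    rw [conjTranspose_mul, ← Matrix.mul_assoc, Matrix.mul_assoc Uᴴ]
    exact h
  have htr : (P * X).trace = ((P * U)ᴴ * (X * U)).trace := by
    rw [conjTranspose_mul, hP, Matrix.mul_assoc, Matrix.trace_mul_comm Uᴴ, Matrix.mul_assoc P,
      Matrix.mul_assoc X, hUU', Matrix.mul_one]
  have hone : ∀ s, ∑ i, ‖(P * U) i s‖ ^ 2 ≤ 1 := fun s => by
    have h1 : ((1 - P)ᴴ * (1 - P)) = 1 - P := by
      rw [conjTranspose_sub, conjTranspose_one, hP, Matrix.sub_mul, Matrix.one_mul, Matrix.mul_sub,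
        Matrix.mul_one, hPP, sub_self, sub_zero]
    have h2 : ((1 - P).PosSemidef) := h1 ▸ posSemidef_conjTranspose_mul_self _
    have h3 := (h2.conjTranspose_mul_mul_same U).diag_nonneg (i := s)
    have h4 : Uᴴ * (1 - P) * U = 1 - (P * U)ᴴ * (P * U) := by
      rw [conjTranspose_mul, hP, Matrix.mul_sub, Matrix.sub_mul, Matrix.mul_one, hUU,
        Matrix.mul_assoc Uᴴ P (P * U), ← Matrix.mul_assoc P P U, hPP, Matrix.mul_assoc]
    rw [h4, Matrix.sub_apply, one_apply_eq] at h3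
    have h5 := (Complex.le_def.mp h3).1
    have h6 : (((P * U)ᴴ * (P * U)) s s).re = ∑ i, ‖(P * U) i s‖ ^ 2 := by
      rw [Matrix.mul_apply, Complex.re_sum]
      refine Finset.sum_congr rfl fun i _ => ?_
      rw [conjTranspose_apply, ← Complex.normSq_eq_norm_sq, RCLike.star_def,
        ← Complex.normSq_eq_conj_mul_self, Complex.ofReal_re]
    simp only [Complex.zero_re, Complex.sub_re, Complex.one_re, h6] at h5
    linarith
  have heig : ∀ s, ∑ i, ‖(X * U) i s‖ ^ 2 = hX.eigenvalues s := fun s => by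
    have h := congrArg Complex.re (congrFun (congrFun hdiag s) s)
    rw [diagonal_apply_eq, Complex.ofReal_re, Matrix.mul_apply, Complex.re_sum] at h
    rw [← h]
    refine Finset.sum_congr rfl fun i _ => ?_
    rw [conjTranspose_apply, ← Complex.normSq_eq_norm_sq, RCLike.star_def,
      ← Complex.normSq_eq_conj_mul_self, Complex.ofReal_re]
  rw [htr, Matrix.trace, Complex.re_sum, traceNorm]
  refine (Finset.abs_sum_le_sum_abs _ _).trans (Finset.sum_le_sum fun s _ => ?_)
  rw [Matrix.diag_apply, Matrix.mul_apply, ← heig s]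
  calc |(∑ i, (P * U)ᴴ s i * (X * U) i s).re|
      ≤ ∑ i, ‖(P * U) i s‖ * ‖(X * U) i s‖ :=
        (Complex.abs_re_le_norm _).trans <| norm_sum_le_of_le _ fun i _ => by
          rw [norm_mul, conjTranspose_apply, norm_star]
    _ ≤ √(∑ i, ‖(P * U) i s‖ ^ 2) * √(∑ i, ‖(X * U) i s‖ ^ 2) :=
        Real.sum_mul_le_sqrt_mul_sqrt _ _ _
    _ ≤ 1 * √(∑ i, ‖(X * U) i s‖ ^ 2) := by
        gcongr
        exact Real.sqrt_le_one.mpr (hone s)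
    _ = _ := one_mul _

theorem hsSq_kronecker (X : Matrix S T ℂ) {S' T' : Type} [Fintype S'] [Fintype T']
    (Y : Matrix S' T' ℂ) : hsSq (X ⊗ₖ Y) = hsSq X * hsSq Y := by
  have h : ((hsSq (X ⊗ₖ Y) : ℝ) : ℂ) = ((hsSq X * hsSq Y : ℝ) : ℂ) := by
    rw [Complex.ofReal_mul, ofReal_hsSq, ofReal_hsSq, ofReal_hsSq, conjTranspose_kronecker,
      ← mul_kronecker_mul, trace_kronecker]
  exact_mod_cast h

end MatrixFacts

/-! ### Bounds on expectations in product states. -/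

section Separability

variable {C A B C₁ A₁ B₁ C₂ A₂ B₂ : Type} [Fintype C] [Fintype A] [Fintype B]
  [Fintype C₁] [Fintype A₁] [Fintype B₁] [Fintype C₂] [Fintype A₂] [Fintype B₂]

/-- The expectation of `F` in product states of `C`, `A`, `B` is at most `r`. -/
def SepBound (F : Matrix (C × A × B) (C × A × B) ℂ) (r : ℝ) : Prop :=
  ∀ (c : Matrix C C ℂ) (a : Matrix A A ℂ) (b : Matrix B B ℂ), c.PosSemidef → a.PosSemidef →
    b.PosSemidef → (F * (c ⊗ₖ (a ⊗ₖ b))).trace.re ≤ r * (c.trace.re * (a.trace.re * b.trace.re))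

/-- The expectation of `F ⊗ R` in product states of `C C₂`, `A A₂`, `B B₂` is at most `r`; the pure
states of `C C₂`, `A A₂`, `B B₂` are represented by matrices. -/
def SepBoundWith (R : Matrix (C₂ × A₂ × B₂) (C₂ × A₂ × B₂) ℂ)
    (F : Matrix (C × A × B) (C × A × B) ℂ) (r : ℝ) : Prop :=
  ∀ (c : Matrix C C₂ ℂ) (a : Matrix A A₂ ℂ) (b : Matrix B B₂ ℂ),
    ((c ⊗ₖ (a ⊗ₖ b))ᴴ * F * (c ⊗ₖ (a ⊗ₖ b)) * Rᵀ).trace.re ≤ r * (hsSq c * (hsSq a * hsSq b))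

/-- The reduced operator on `C₂` of the vector represented by `c` is `(cᴴ * c)ᵀ`, so a product
vector has product marginals, to which the bound on `R` applies. -/
theorem SepBound.re_trace_mul_transpose_le {R : Matrix (C₂ × A₂ × B₂) (C₂ × A₂ × B₂) ℂ} {s : ℝ}
    (hR : SepBound R s) (c : Matrix C C₂ ℂ) (a : Matrix A A₂ ℂ) (b : Matrix B B₂ ℂ) :
    ((cᴴ * c) ⊗ₖ ((aᴴ * a) ⊗ₖ (bᴴ * b)) * Rᵀ).trace.re ≤ s * (hsSq c * (hsSq a * hsSq b)) := by
  have h := hR (cᴴ * c)ᵀ (aᴴ * a)ᵀ (bᴴ * b)ᵀ (posSemidef_conjTranspose_mul_self c).transpose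
    (posSemidef_conjTranspose_mul_self a).transpose (posSemidef_conjTranspose_mul_self b).transpose
  rw [trace_transpose, trace_transpose, trace_transpose] at h
  rw [← Matrix.trace_transpose, Matrix.transpose_mul, transpose_transpose]
  exact h

theorem kronecker_conjTranspose_mul_self {C A B C₂ A₂ B₂ : Type} [Fintype C] [Fintype A]
    [Fintype B] (c : Matrix C C₂ ℂ) (a : Matrix A A₂ ℂ)
    (b : Matrix B B₂ ℂ) : (c ⊗ₖ (a ⊗ₖ b))ᴴ * (c ⊗ₖ (a ⊗ₖ b)) =
      (cᴴ * c) ⊗ₖ ((aᴴ * a) ⊗ₖ (bᴴ * b)) := by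
  simp only [conjTranspose_kronecker, ← mul_kronecker_mul]

theorem SepBound.sepBoundWith_one [DecidableEq C] [DecidableEq A] [DecidableEq B]
    {R : Matrix (C₂ × A₂ × B₂) (C₂ × A₂ × B₂) ℂ} {s : ℝ}
    (hR : SepBound R s) : SepBoundWith R (1 : Matrix (C × A × B) (C × A × B) ℂ) s := by
  intro c a b
  rw [Matrix.mul_one, kronecker_conjTranspose_mul_self]
  exact hR.re_trace_mul_transpose_le c a b

theorem SepBoundWith.mono {R : Matrix (C₂ × A₂ × B₂) (C₂ × A₂ × B₂) ℂ}
    {F G : Matrix (C × A × B) (C × A × B) ℂ} {r : ℝ} (hR : R.PosSemidef)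
    (hFG : (G - F).PosSemidef) (hG : SepBoundWith R G r) : SepBoundWith R F r := by
  intro c a b
  refine le_trans ?_ (hG c a b)
  have h := (Complex.le_def.mp (trace_mul_nonneg
    (hFG.conjTranspose_mul_mul_same (c ⊗ₖ (a ⊗ₖ b))) hR.transpose)).1
  rw [Matrix.mul_sub, Matrix.sub_mul, Matrix.sub_mul, Matrix.trace_sub, Complex.sub_re,
    Complex.zero_re] at h
  linarith

/-- Product Kraus operators send product vectors to product vectors, and the squared norms of the
images add up to the original one. The bounds for the branches therefore average to the same `r`. -/
theorem SepBoundWith.kraus [DecidableEq C] [DecidableEq A] [DecidableEq B]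
    {R : Matrix (C₂ × A₂ × B₂) (C₂ × A₂ × B₂) ℂ} {I : Type} [Fintype I]
    {F : I → Matrix (C₁ × A₁ × B₁) (C₁ × A₁ × B₁) ℂ} {r : ℝ}
    (hF : ∀ i, SepBoundWith R (F i) r) {k : I → Matrix C₁ C ℂ} {s : I → Matrix A₁ A ℂ}
    {t : I → Matrix B₁ B ℂ} (hK : IsKraus fun i => k i ⊗ₖ (s i ⊗ₖ t i)) :
    SepBoundWith R (∑ i, (k i ⊗ₖ (s i ⊗ₖ t i))ᴴ * F i * (k i ⊗ₖ (s i ⊗ₖ t i))) r := by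
  intro c a b
  have h : ∀ i, (k i ⊗ₖ (s i ⊗ₖ t i)) * (c ⊗ₖ (a ⊗ₖ b)) =
      (k i * c) ⊗ₖ ((s i * a) ⊗ₖ (t i * b)) := fun i => by
    simp only [← mul_kronecker_mul]
  have h' := hsSq_kraus hK (c ⊗ₖ (a ⊗ₖ b))
  simp only [h, hsSq_kronecker] at h'
  rw [← h', Finset.mul_sum, Matrix.mul_sum, Matrix.sum_mul, Matrix.sum_mul, Matrix.trace_sum,
    Complex.re_sum]
  refine Finset.sum_le_sum fun i _ => le_trans (le_of_eq ?_) (hF i (k i * c) (s i * a) (t i * b))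
  rw [← h, conjTranspose_mul]
  simp only [Matrix.mul_assoc]

/-- A bijection `C A B ≃ (C₁ A₁ B₁) (C₂ A₂ B₂)` that acts on each party separately. -/
@[simps]
def splitEquiv (eC : C ≃ C₁ × C₂) (eA : A ≃ A₁ × A₂) (eB : B ≃ B₁ × B₂) :
    C × A × B ≃ (C₁ × A₁ × B₁) × (C₂ × A₂ × B₂) where
  toFun x := (((eC x.1).1, (eA x.2.1).1, (eB x.2.2).1), ((eC x.1).2, (eA x.2.1).2, (eB x.2.2).2))
  invFun y := (eC.symm (y.1.1, y.2.1), eA.symm (y.1.2.1, y.2.2.1), eB.symm (y.1.2.2, y.2.2.2))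
  left_inv x := by simp
  right_inv y := by simp

/-- This justifies the form of `SepBoundWith`: the trace is `⟨V| F ⊗ R |V⟩` when the matrix `V` is
read as a vector. -/
theorem trace_conjTranspose_mul_mul_mul_transpose {S S₂ : Type} [Fintype S] [Fintype S₂]
    (V : Matrix S S₂ ℂ) (F : Matrix S S ℂ) (R : Matrix S₂ S₂ ℂ) :
    (Vᴴ * F * V * Rᵀ).trace =
      ∑ p : S × S₂, ∑ q : S × S₂, star (V p.1 p.2) * (F ⊗ₖ R) p q * V q.1 q.2 := by
  simp only [Matrix.trace, Matrix.diag_apply, Matrix.mul_apply, Fintype.sum_prod_type,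
    Finset.sum_mul, conjTranspose_apply, transpose_apply, kroneckerMap_apply]
  conv_rhs => rw [Finset.sum_comm]
  refine Finset.sum_congr rfl fun i _ => ?_
  rw [Finset.sum_comm]
  conv_rhs => rw [Finset.sum_comm]
  refine Finset.sum_congr rfl fun y _ => ?_
  rw [Finset.sum_comm]
  exact Finset.sum_congr rfl fun x _ => Finset.sum_congr rfl fun j _ => by ring

/-- Positive operators are sums of rank-one operators, and both sides are additive in these, so the
bound for pure states suffices. -/
theorem SepBoundWith.sepBound (eC : C ≃ C₁ × C₂) (eA : A ≃ A₁ × A₂) (eB : B ≃ B₁ × B₂)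
    {F : Matrix (C₁ × A₁ × B₁) (C₁ × A₁ × B₁) ℂ} {R : Matrix (C₂ × A₂ × B₂) (C₂ × A₂ × B₂) ℂ}
    {r : ℝ} (h : SepBoundWith R F r) :
    SepBound ((F ⊗ₖ R).submatrix (splitEquiv eC eA eB) (splitEquiv eC eA eB)) r := by
  intro c a b hc ha hb
  obtain ⟨Yc, rfl⟩ := exists_eq_conjTranspose_mul_self hc
  obtain ⟨Ya, rfl⟩ := exists_eq_conjTranspose_mul_self ha
  obtain ⟨Yb, rfl⟩ := exists_eq_conjTranspose_mul_self hb
  -- `Yᴴ * Y` is the sum of the projectors onto the conjugated rows of `Y`, up to their norms; each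
  -- row is reshaped into a matrix.
  let vc : C → Matrix C₁ C₂ ℂ := fun k => Matrix.of fun i j => star (Yc k (eC.symm (i, j)))
  let va : A → Matrix A₁ A₂ ℂ := fun k => Matrix.of fun i j => star (Ya k (eA.symm (i, j)))
  let vb : B → Matrix B₁ B₂ ℂ := fun k => Matrix.of fun i j => star (Yb k (eB.symm (i, j)))
  have hs : ∀ {D D₁ D₂ : Type} [Fintype D] [Fintype D₁] [Fintype D₂] (e : D ≃ D₁ × D₂)
      (Y : Matrix D D ℂ),
      ∑ k, hsSq (Matrix.of fun i j => star (Y k (e.symm (i, j)))) = (Yᴴ * Y).trace.re := by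
    intro D D₁ D₂ _ _ _ e Y
    rw [← hsSq, hsSq_eq_sum]
    refine Finset.sum_congr rfl fun k _ => ?_
    simp only [hsSq_eq_sum, of_apply, norm_star]
    rw [← Fintype.sum_prod_type' (f := fun i j => ‖Y k (e.symm (i, j))‖ ^ 2)]
    exact Equiv.sum_comp e.symm fun x => ‖Y k x‖ ^ 2
  set e := splitEquiv eC eA eB
  have hrhs : r * ((Ycᴴ * Yc).trace.re * ((Yaᴴ * Ya).trace.re * (Ybᴴ * Yb).trace.re)) =
      ∑ z : C × A × B, r * (hsSq (vc z.1) * (hsSq (va z.2.1) * hsSq (vb z.2.2))) := by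
    rw [← hs eC, ← hs eA, ← hs eB]
    simp only [Fintype.sum_prod_type, ← Finset.mul_sum, ← Finset.sum_mul]
    rfl
  rw [hrhs, ← kronecker_conjTranspose_mul_self, ← Matrix.mul_assoc, Matrix.trace_mul_comm,
    ← Matrix.mul_assoc, Matrix.trace, Complex.re_sum]
  refine Finset.sum_le_sum fun z _ => le_trans (le_of_eq ?_) (h (vc z.1) (va z.2.1) (vb z.2.2))
  rw [trace_conjTranspose_mul_mul_mul_transpose, Matrix.diag_apply, Matrix.mul_apply]
  simp only [Matrix.mul_apply, Finset.sum_mul]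
  rw [Finset.sum_comm, ← Equiv.sum_comp e.symm]
  refine congrArg Complex.re (Finset.sum_congr rfl fun p _ => ?_)
  rw [← Equiv.sum_comp e.symm]
  refine Finset.sum_congr rfl fun q _ => ?_
  simp [e, vc, va, vb, kroneckerMap_apply]

end Separability

/-! ### The privacy test and its behaviour in product states. -/

section PrivacyTest

variable {A B : Type} [Fintype A] [Fintype B] {m : ℕ}

/-- The isometry `2^{-m/2} ∑ᵢ |ii⟩ ⊗ Uᵢ` that prepares a private state from its shield. -/
noncomputable def keyIsometry (U : Fin (2 ^ m) → Matrix (A × B) (A × B) ℂ) :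
    Matrix ((Fin (2 ^ m) × A) × (Fin (2 ^ m) × B)) (A × B) ℂ :=
  Matrix.of fun x y =>
    if x.1.1 = x.2.1 then (((√(2 ^ m))⁻¹ : ℝ) : ℂ) * U x.1.1 (x.1.2, x.2.2) y else 0

theorem keyIsometry_coeff_mul_self :
    (((√(2 ^ m))⁻¹ : ℝ) : ℂ) * (((√(2 ^ m))⁻¹ : ℝ) : ℂ) = 1 / 2 ^ m := by
  rw [← Complex.ofReal_mul, ← mul_inv, Real.mul_self_sqrt (by positivity)]
  push_cast
  rw [one_div]

/-- Only the blocks in which Alice and Bob hold the same key value `i` survive. -/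
theorem conjTranspose_keyIsometry_mul_kronecker (U : Fin (2 ^ m) → Matrix (A × B) (A × B) ℂ)
    {A₂ B₂ : Type} (a : Matrix (Fin (2 ^ m) × A) A₂ ℂ) (b : Matrix (Fin (2 ^ m) × B) B₂ ℂ) :
    (keyIsometry U)ᴴ * (a ⊗ₖ b) = (((√(2 ^ m))⁻¹ : ℝ) : ℂ) •
      ∑ i, (U i)ᴴ * (a.submatrix (Prod.mk i) id ⊗ₖ b.submatrix (Prod.mk i) id) := by
  ext x y
  simp only [Matrix.mul_apply, Matrix.smul_apply, Matrix.sum_apply, Fintype.sum_prod_type,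
    conjTranspose_apply, keyIsometry, of_apply, kroneckerMap_apply, submatrix_apply, id]
  rw [smul_eq_mul, Finset.mul_sum]
  refine Finset.sum_congr rfl fun i _ => ?_
  rw [Finset.mul_sum]
  refine Finset.sum_congr rfl fun j _ => ?_
  rw [Finset.sum_eq_single i, Finset.mul_sum]
  · refine Finset.sum_congr rfl fun k _ => ?_
    simp [mul_assoc]
  · intro l _ hl
    simp [hl.symm]
  · simp

theorem conjTranspose_keyIsometry_mul_self [DecidableEq A] [DecidableEq B]
    {U : Fin (2 ^ m) → Matrix (A × B) (A × B) ℂ}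
    (hU : ∀ i, U i ∈ Matrix.unitaryGroup (A × B) ℂ) :
    (keyIsometry U)ᴴ * keyIsometry U = 1 := by
  ext x y
  have h : ∀ i, ∑ j, ∑ k, star (U i (j, k) x) * U i (j, k) y = (1 : Matrix _ _ ℂ) x y := fun i => by
    rw [← Unitary.star_mul_self_of_mem (hU i), Matrix.mul_apply, Fintype.sum_prod_type]
    rfl
  calc ((keyIsometry U)ᴴ * keyIsometry U) x y
      = ∑ i : Fin (2 ^ m), (1 / 2 ^ m : ℂ) * ∑ j, ∑ k, star (U i (j, k) x) * U i (j, k) y := by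
        rw [Matrix.mul_apply]
        simp only [Fintype.sum_prod_type, conjTranspose_apply, keyIsometry, of_apply]
        refine Finset.sum_congr rfl fun i _ => ?_
        rw [Finset.mul_sum]
        refine Finset.sum_congr rfl fun j _ => ?_
        rw [Finset.sum_eq_single i, Finset.mul_sum]
        · refine Finset.sum_congr rfl fun k _ => ?_
          rw [← keyIsometry_coeff_mul_self]
          simp
          ring
        · intro l _ hl
          simp [hl.symm]
        · simp
    _ = _ := by
        simp_rw [h]
        simp

theorem keyIsometry_mul_mul_conjTranspose (U : Fin (2 ^ m) → Matrix (A × B) (A × B) ℂ)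
    (σ : Matrix (A × B) (A × B) ℂ) :
    keyIsometry U * σ * (keyIsometry U)ᴴ = Matrix.of fun x y =>
      if x.1.1 = x.2.1 ∧ y.1.1 = y.2.1 then
        (1 / 2 ^ m : ℂ) * (U x.1.1 * σ * (U y.1.1)ᴴ) (x.1.2, x.2.2) (y.1.2, y.2.2)
      else 0 := by
  ext x y
  rw [of_apply, ← keyIsometry_coeff_mul_self]
  simp only [Matrix.mul_apply, keyIsometry, of_apply, conjTranspose_apply]
  by_cases hx : x.1.1 = x.2.1
  · by_cases hy : y.1.1 = y.2.1
    · simp only [hx, hy, if_true, and_self, Finset.mul_sum, Finset.sum_mul]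
      refine Finset.sum_congr rfl fun i _ => Finset.sum_congr rfl fun j _ => ?_
      simp
      ring
    · simp [hy]
  · simp [hx]

/-- The projection onto the range of `keyIsometry U`, which is passed by the private state. -/
noncomputable def privacyTest (U : Fin (2 ^ m) → Matrix (A × B) (A × B) ℂ) :
    Matrix ((Fin (2 ^ m) × A) × (Fin (2 ^ m) × B)) ((Fin (2 ^ m) × A) × (Fin (2 ^ m) × B)) ℂ :=
  keyIsometry U * (keyIsometry U)ᴴ

theorem conjTranspose_privacyTest (U : Fin (2 ^ m) → Matrix (A × B) (A × B) ℂ) :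
    (privacyTest U)ᴴ = privacyTest U := by
  rw [privacyTest, conjTranspose_mul, conjTranspose_conjTranspose]

theorem privacyTest_mul_self [DecidableEq A] [DecidableEq B]
    {U : Fin (2 ^ m) → Matrix (A × B) (A × B) ℂ}
    (hU : ∀ i, U i ∈ Matrix.unitaryGroup (A × B) ℂ) :
    privacyTest U * privacyTest U = privacyTest U := by
  rw [privacyTest, Matrix.mul_assoc, ← Matrix.mul_assoc _ (keyIsometry U),
    conjTranspose_keyIsometry_mul_self hU, Matrix.one_mul]

theorem IsPrivateState.exists_test [DecidableEq A] [DecidableEq B]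
   
    {γ : Matrix ((Fin (2 ^ m) × A) × (Fin (2 ^ m) × B)) ((Fin (2 ^ m) × A) × (Fin (2 ^ m) × B)) ℂ}
    (hγ : IsPrivateState m γ) : ∃ U : Fin (2 ^ m) → Matrix (A × B) (A × B) ℂ,
      (∀ i, U i ∈ Matrix.unitaryGroup (A × B) ℂ) ∧ (privacyTest U * γ).trace = 1 := by
  obtain ⟨U, σ, hU, hσ, rfl⟩ := hγ
  refine ⟨U, hU, ?_⟩
  rw [← keyIsometry_mul_mul_conjTranspose, privacyTest, ← Matrix.mul_assoc, ← Matrix.mul_assoc,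
    Matrix.mul_assoc (keyIsometry U), conjTranspose_keyIsometry_mul_self hU, Matrix.mul_one,
    Matrix.trace_mul_comm, ← Matrix.mul_assoc, conjTranspose_keyIsometry_mul_self hU,
    Matrix.one_mul, hσ.2]

theorem sum_hsSq_submatrix {A A₂ : Type} [Fintype A] [Fintype A₂] (a : Matrix (Fin (2 ^ m) × A) A₂ ℂ) :
    ∑ i, hsSq (a.submatrix (Prod.mk i) id) = hsSq a := by
  simp [hsSq_eq_sum, Fintype.sum_prod_type]

/-- The heart of the proof. The amplitude is `2^{-m/2} ∑ᵢ Uᵢᴴ (aᵢ ⊗ bᵢ)` with `aᵢ`, `bᵢ` the key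
blocks of `a`, `b`. The twist `Uᵢ` acts on the shields only and so does not affect the expectation
of `R`: each term contributes at most `√s ‖c‖ ‖aᵢ‖ ‖bᵢ‖`, and `∑ᵢ ‖aᵢ‖ ‖bᵢ‖ ≤ ‖a‖ ‖b‖`. -/
theorem SepBound.sepBoundWith_privacyTest [DecidableEq A] [DecidableEq B]
    {C C₂ A₂ B₂ : Type} [Fintype C] [DecidableEq C]
    [Fintype C₂] [Fintype A₂] [Fintype B₂] {R : Matrix (C₂ × A₂ × B₂) (C₂ × A₂ × B₂) ℂ} {s : ℝ}
    (hs : 0 ≤ s) (hR : R.PosSemidef) (hRs : SepBound R s)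
    {U : Fin (2 ^ m) → Matrix (A × B) (A × B) ℂ}
    (hU : ∀ i, U i ∈ Matrix.unitaryGroup (A × B) ℂ) :
    SepBoundWith R ((1 : Matrix C C ℂ) ⊗ₖ privacyTest U) (s / 2 ^ m) := by
  intro c a b
  -- A square root of `Rᵀ` turns expectations into Hilbert–Schmidt norms, so that the triangle
  -- inequality is available.
  obtain ⟨Y, hY⟩ := exists_eq_conjTranspose_mul_self hR.transpose
  set W := keyIsometry U
  set κ : ℂ := (((√(2 ^ m))⁻¹ : ℝ) : ℂ) with hκ
  let a' := fun i => a.submatrix (Prod.mk i) id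
  let b' := fun i => b.submatrix (Prod.mk i) id
  let Z := fun i => c ⊗ₖ ((U i)ᴴ * (a' i ⊗ₖ b' i))
  have hZ : ((1 : Matrix C C ℂ) ⊗ₖ Wᴴ) * (c ⊗ₖ (a ⊗ₖ b)) = κ • ∑ i, Z i := by
    rw [← mul_kronecker_mul, Matrix.one_mul, conjTranspose_keyIsometry_mul_kronecker,
      kronecker_smul]
    congr 1
    ext x y
    simp [Z, a', b', Matrix.sum_apply, kroneckerMap_apply, Finset.mul_sum]
  have hnorm : ∀ X : Matrix (C × A × B) (C₂ × A₂ × B₂) ℂ,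
      hsSq (X * Yᴴ) = (Xᴴ * X * Rᵀ).trace.re := fun X => by
    rw [hsSq, conjTranspose_mul, conjTranspose_conjTranspose, hY, Matrix.mul_assoc,
      Matrix.trace_mul_comm, Matrix.mul_assoc, Matrix.mul_assoc, Matrix.mul_assoc]
  have hform : ((c ⊗ₖ (a ⊗ₖ b))ᴴ * ((1 : Matrix C C ℂ) ⊗ₖ privacyTest U) *
      (c ⊗ₖ (a ⊗ₖ b)) * Rᵀ).trace.re = hsSq (κ • ∑ i, Z i * Yᴴ) := by
    have hT : (1 : Matrix C C ℂ) ⊗ₖ privacyTest U =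
        ((1 : Matrix C C ℂ) ⊗ₖ Wᴴ)ᴴ * ((1 : Matrix C C ℂ) ⊗ₖ Wᴴ) := by
      rw [conjTranspose_kronecker, ← mul_kronecker_mul, conjTranspose_one, Matrix.one_mul,
        conjTranspose_conjTranspose, privacyTest]
    rw [← Matrix.sum_mul, ← Matrix.smul_mul, ← hZ, hnorm, conjTranspose_mul, hT]
    simp only [Matrix.mul_assoc]
  have hterm : ∀ i, hsSq (Z i * Yᴴ) ≤ s * (hsSq c * (hsSq (a' i) * hsSq (b' i))) := fun i => by
    refine le_trans (le_of_eq ?_) (hRs.re_trace_mul_transpose_le c (a' i) (b' i))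
    -- Here the twist cancels; what remains is the product vector with components `c`, `a' i`, `b'
    -- i`.
    have hUU : U i * (U i)ᴴ = 1 := Unitary.mul_star_self_of_mem (hU i)
    rw [hnorm, conjTranspose_kronecker, ← mul_kronecker_mul, conjTranspose_mul,
      conjTranspose_conjTranspose, Matrix.mul_assoc, ← Matrix.mul_assoc (U i),
      hUU, Matrix.one_mul, conjTranspose_kronecker, ← mul_kronecker_mul]
  have hsum : √(hsSq (∑ i, Z i * Yᴴ)) ≤ √(s * hsSq c) * (√(hsSq a) * √(hsSq b)) :=
    calc √(hsSq (∑ i, Z i * Yᴴ)) ≤ ∑ i, √(hsSq (Z i * Yᴴ)) := sqrt_hsSq_sum_le _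
      _ ≤ ∑ i, √(s * hsSq c) * (√(hsSq (a' i)) * √(hsSq (b' i))) := by
        refine Finset.sum_le_sum fun i _ => ?_
        rw [← Real.sqrt_mul (hsSq_nonneg _), ← Real.sqrt_mul (mul_nonneg hs (hsSq_nonneg _)),
          mul_assoc]
        exact Real.sqrt_le_sqrt (hterm i)
      _ ≤ _ := by
        rw [← Finset.mul_sum, ← sum_hsSq_submatrix a, ← sum_hsSq_submatrix b]
        gcongr
        exact Real.sum_sqrt_mul_sqrt_le _ (fun i => hsSq_nonneg _) (fun i => hsSq_nonneg _)
  have hsq : hsSq (∑ i, Z i * Yᴴ) ≤ s * (hsSq c * (hsSq a * hsSq b)) := by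
    have h := mul_self_le_mul_self (Real.sqrt_nonneg _) hsum
    rw [Real.mul_self_sqrt (hsSq_nonneg _)] at h
    refine h.trans (le_of_eq ?_)
    have h1 := Real.mul_self_sqrt (mul_nonneg hs (hsSq_nonneg c))
    have h2 := Real.mul_self_sqrt (hsSq_nonneg a)
    have h3 := Real.mul_self_sqrt (hsSq_nonneg b)
    calc _ = (√(s * hsSq c) * √(s * hsSq c)) * ((√(hsSq a) * √(hsSq a)) *
          (√(hsSq b) * √(hsSq b))) := by ring
      _ = _ := by rw [h1, h2, h3]; ring
  have hκ2 : ‖κ‖ ^ 2 = (2 ^ m)⁻¹ := by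
    rw [hκ, Complex.norm_real, Real.norm_eq_abs, sq_abs, inv_pow, Real.sq_sqrt (by positivity)]
  rw [hform, hsSq_smul, hκ2, div_eq_inv_mul, mul_assoc]
  gcongr

theorem SepBound.sepBoundWith_one_sub_privacyTest [DecidableEq A] [DecidableEq B]
    {C C₂ A₂ B₂ : Type} [Fintype C] [DecidableEq C]
    [Fintype C₂] [Fintype A₂] [Fintype B₂] {R : Matrix (C₂ × A₂ × B₂) (C₂ × A₂ × B₂) ℂ} {s : ℝ}
    (hR : R.PosSemidef) (hRs : SepBound R s) (U : Fin (2 ^ m) → Matrix (A × B) (A × B) ℂ) :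
    SepBoundWith R ((1 : Matrix C C ℂ) ⊗ₖ (1 - privacyTest U)) s := by
  refine SepBoundWith.mono hR ?_ hRs.sepBoundWith_one
  have h : (1 : Matrix (C × _) (C × _) ℂ) - 1 ⊗ₖ (1 - privacyTest U) = 1 ⊗ₖ privacyTest U := by
    rw [← one_kronecker_one]
    ext x y
    simp only [Matrix.sub_apply, kroneckerMap_apply]
    ring
  rw [h]
  exact PosSemidef.one.kronecker (posSemidef_self_mul_conjTranspose _)

end PrivacyTest

/-! ### Pulling a measurement back through an LOCC operation. -/

section Implementation

variable {X C A B C₁ A₁ B₁ C' A' B' : Type} [Fintype C] [DecidableEq C] [Fintype A]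
  [DecidableEq A] [Fintype B] [DecidableEq B] [Fintype C₁] [Fintype A₁] [Fintype B₁]
  [Fintype C'] [DecidableEq C'] [Fintype A'] [Fintype B']

theorem traceFst_sum {I C S : Type} [Fintype I] [Fintype C]
    (M : I → Matrix (C × S) (C × S) ℂ) : traceFst (∑ i, M i) = ∑ i, traceFst (M i) := by
  ext s t
  simp only [traceFst, of_apply, Matrix.sum_apply]
  exact Finset.sum_comm

theorem trace_one_kronecker_mul {S : Type} [Fintype S] (Q : Matrix S S ℂ)
    (ρ : Matrix (C × S) (C × S) ℂ) :
    (((1 : Matrix C C ℂ) ⊗ₖ Q) * ρ).trace = (Q * traceFst ρ).trace := by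
  simp only [Matrix.trace, Matrix.diag_apply, Matrix.mul_apply, Fintype.sum_prod_type,
    kroneckerMap_apply, traceFst, of_apply, one_apply, ite_mul, one_mul, zero_mul,
    Finset.mul_sum]
  rw [Finset.sum_comm]
  refine Finset.sum_congr rfl fun s _ => ?_
  rw [Finset.sum_comm (s := Finset.univ) (t := Finset.univ) (f := fun t c => Q s t * ρ (c, t) (c, s))]
  refine Finset.sum_congr rfl fun c _ => ?_
  rw [Finset.sum_eq_single c]
  · simp
  · intro d _ hd
    simp [hd.symm]
  · simp

/-- The measurement `E` is the measurement `Q` after the operation `Λ` and the partial trace over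
`C'`; it inherits from `Q` the bounds on expectations in product states. -/
def Implements (Q : X → Matrix (A' × B') (A' × B') ℂ)
    (Λ : Matrix (C × A × B) (C × A × B) ℂ → Matrix (C' × A' × B') (C' × A' × B') ℂ)
    (E : X → Matrix (C × A × B) (C × A × B) ℂ) : Prop :=
  (∀ x ρ, (E x * ρ).trace = (Q x * traceFst (Λ ρ)).trace) ∧
    ∀ {C₂ A₂ B₂ : Type} [Fintype C₂] [Fintype A₂] [Fintype B₂]
      (R : Matrix (C₂ × A₂ × B₂) (C₂ × A₂ × B₂) ℂ) (x : X) (r : ℝ),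
      SepBoundWith R ((1 : Matrix C' C' ℂ) ⊗ₖ Q x) r → SepBoundWith R (E x) r

theorem implements_id (Q : X → Matrix (A' × B') (A' × B') ℂ) :
    Implements (C' := C') Q (fun ρ => ρ) (fun x => (1 : Matrix C' C' ℂ) ⊗ₖ Q x) :=
  ⟨fun x ρ => trace_one_kronecker_mul (Q x) ρ, fun _ _ _ h => h⟩

/-- The Heisenberg picture of one round: cyclicity of the trace moves the Kraus operators onto the
measurement. -/
theorem Implements.kraus {Q : X → Matrix (A' × B') (A' × B') ℂ} {I : Type} [Fintype I]
    [DecidableEq C₁] [DecidableEq A₁] [DecidableEq B₁]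
    {Λ : I → Matrix (C₁ × A₁ × B₁) (C₁ × A₁ × B₁) ℂ → Matrix (C' × A' × B') (C' × A' × B') ℂ}
    {E : I → X → Matrix (C₁ × A₁ × B₁) (C₁ × A₁ × B₁) ℂ} (h : ∀ i, Implements Q (Λ i) (E i))
    {k : I → Matrix C₁ C ℂ} {s : I → Matrix A₁ A ℂ} {t : I → Matrix B₁ B ℂ}
    (hK : IsKraus fun i => k i ⊗ₖ (s i ⊗ₖ t i)) :
    Implements Q (fun ρ => ∑ i, Λ i ((k i ⊗ₖ (s i ⊗ₖ t i)) * ρ * (k i ⊗ₖ (s i ⊗ₖ t i))ᴴ))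
      (fun x => ∑ i, (k i ⊗ₖ (s i ⊗ₖ t i))ᴴ * E i x * (k i ⊗ₖ (s i ⊗ₖ t i))) := by
  refine ⟨fun x ρ => ?_, fun R x r hr => SepBoundWith.kraus (fun i => (h i).2 R x r hr) hK⟩
  rw [Matrix.sum_mul, traceFst_sum, Matrix.mul_sum, Matrix.trace_sum, Matrix.trace_sum]
  refine Finset.sum_congr rfl fun i _ => ?_
  rw [← (h i).1, Matrix.mul_assoc, Matrix.mul_assoc, Matrix.trace_mul_comm]
  simp only [Matrix.mul_assoc]

theorem IsLOCCMeasurement.of_isKraus_right [DecidableEq X] [Fintype X] {D : Type} [Fintype D]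
    [DecidableEq D] {P : X → Matrix D D ℂ} (hP : IsKraus P) :
    IsLOCCMeasurement fun x => (1 : Matrix C C ℂ) ⊗ₖ ((P x)ᴴ * P x) := by
  -- One round on the right, whose outcome is announced unchanged.
  have h := IsLOCCMeasurement.right (C := C) P hP _ fun i => IsLOCCMeasurement.announce i
  convert h using 2 with x
  rw [Finset.sum_eq_single x]
  · simp [conjTranspose_kronecker, ← mul_kronecker_mul]
  · intro i _ hi
    simp [hi.symm]
  · simp

/-- Rounds of Alice and of Bob both become rounds of the joint party `AB`, which finally can measure
`P` globally on `A' B'`. -/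
theorem IsLOCC.exists_measurement [DecidableEq A'] [DecidableEq B']
    [Fintype X] [DecidableEq X]
    {Λ : Matrix (C × A × B) (C × A × B) ℂ → Matrix (C' × A' × B') (C' × A' × B') ℂ}
    (hΛ : IsLOCC Λ) {P : X → Matrix (A' × B') (A' × B') ℂ} (hP : IsKraus P) :
    ∃ E, IsLOCCMeasurement E ∧ Implements (fun x => (P x)ᴴ * P x) Λ E := by
  induction hΛ with
  | done => exact ⟨_, IsLOCCMeasurement.of_isKraus_right hP, implements_id _⟩
  | charlie K hK Λ _ ih =>
    choose E hE hE' using ih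
    refine ⟨_, IsLOCCMeasurement.left K hK E hE, ?_⟩
    -- Splitting the identity on `A × B` exhibits Charlie's Kraus operator as a product over the
    -- three parties.
    simp only [← one_kronecker_one (α := ℂ)]
    refine Implements.kraus hE' ?_
    simpa only [one_kronecker_one] using isKraus_kronecker_one hK
  | alice K hK Λ _ ih =>
    choose E hE hE' using ih
    exact ⟨_, IsLOCCMeasurement.right _ (isKraus_kronecker_one hK) E hE,
      Implements.kraus hE' (isKraus_one_kronecker (isKraus_kronecker_one hK))⟩
  | bob K hK Λ _ ih =>
    choose E hE hE' using ih
    exact ⟨_, IsLOCCMeasurement.right _ (isKraus_one_kronecker hK) E hE,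
      Implements.kraus hE' (isKraus_one_kronecker (isKraus_one_kronecker hK))⟩

/-- As Charlie's output is discarded, only his POVM `(K i)ᴴ * K i` matters; the local maps of Alice
and Bob are absorbed into the measurement of `AB` that follows message `i`. -/
theorem IsOneWayLOCC.exists_measurement [DecidableEq A'] [DecidableEq B']
    [Fintype X]
    {Λ : Matrix (C × A × B) (C × A × B) ℂ → Matrix (C' × A' × B') (C' × A' × B') ℂ}
    (hΛ : IsOneWayLOCC Λ) {P : X → Matrix (A' × B') (A' × B') ℂ} (hP : IsKraus P) :
    ∃ E, IsOneWayLOCCMeasurement E ∧ Implements (fun x => (P x)ᴴ * P x) Λ E := by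
  obtain ⟨I, J, L, _, _, _, K, S, T, hK, hS, hT, rfl⟩ := hΛ
  have hST : ∀ i, ∑ j, ∑ l, (S i j ⊗ₖ T i l)ᴴ * (S i j ⊗ₖ T i l) = 1 := fun i => by
    have h : (∑ j, (S i j)ᴴ * S i j) ⊗ₖ (∑ l, (T i l)ᴴ * T i l) = 1 := by
      rw [hS i, hT i, one_kronecker_one]
    rw [← h]
    ext x y
    simp only [conjTranspose_kronecker, ← mul_kronecker_mul, Matrix.sum_apply, kroneckerMap_apply,
      Finset.sum_mul_sum]
  have hL : IsKraus fun z : I × J × L => K z.1 ⊗ₖ (S z.1 z.2.1 ⊗ₖ T z.1 z.2.2) := by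
    have h : (∑ i, ((K i)ᴴ * K i) ⊗ₖ (1 : Matrix (A × B) (A × B) ℂ)) = 1 := by
      rw [← one_kronecker_one (m := C) (n := A × B), ← hK]
      ext x y
      simp only [Matrix.sum_apply, kroneckerMap_apply, Finset.sum_mul]
    change ∑ z : I × J × L, _ = _
    rw [← h, Fintype.sum_prod_type]
    refine Finset.sum_congr rfl fun i _ => ?_
    rw [← hST i, Fintype.sum_prod_type]
    ext x y
    simp only [conjTranspose_kronecker, ← mul_kronecker_mul, Matrix.sum_apply, kroneckerMap_apply,
      Finset.mul_sum]
  have himp := Implements.kraus (fun _ : I × J × L => implements_id (C' := C')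
    fun x => (P x)ᴴ * P x) hL
  simp only [Fintype.sum_prod_type] at himp
  refine ⟨_, ⟨I, inferInstance, fun i => (K i)ᴴ * K i,
    fun i x => ∑ j, ∑ l, (S i j ⊗ₖ T i l)ᴴ * ((P x)ᴴ * P x) * (S i j ⊗ₖ T i l),
    isPOVM_of_isKraus hK, fun i => ⟨fun x => ?_, ?_⟩, ?_⟩, himp⟩
  · exact Matrix.posSemidef_sum _ fun j _ => Matrix.posSemidef_sum _ fun l _ =>
      (posSemidef_conjTranspose_mul_self (P x)).conjTranspose_mul_mul_same _
  · rw [Finset.sum_comm, ← hST i]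
    refine Finset.sum_congr rfl fun j _ => ?_
    rw [Finset.sum_comm]
    refine Finset.sum_congr rfl fun l _ => ?_
    rw [← Matrix.sum_mul, ← Matrix.mul_sum, hP, Matrix.mul_one]
  · funext x
    refine Finset.sum_congr rfl fun i _ => ?_
    ext y z
    simp only [conjTranspose_kronecker, ← mul_kronecker_mul, Matrix.sum_apply, kroneckerMap_apply,
      Finset.mul_sum, Matrix.mul_one]

end Implementation

/-! ### Relabelling and tensor products of LOCC measurements. -/

section Measurements

variable {X C D C' D' C₁ D₁ C₂ D₂ : Type} [Fintype C] [DecidableEq C] [Fintype D] [DecidableEq D]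
  [Fintype C'] [DecidableEq C'] [Fintype D'] [DecidableEq D'] [Fintype C₁] [DecidableEq C₁]
  [Fintype D₁] [DecidableEq D₁] [Fintype C₂] [DecidableEq C₂] [Fintype D₂] [DecidableEq D₂]

theorem isKraus_permutation (e : C' ≃ C) :
    IsKraus fun _ : Unit => (1 : Matrix C C ℂ).submatrix id e := by
  rw [IsKraus, Fintype.sum_unique]
  ext x y
  simp [Matrix.mul_apply, one_apply]

theorem conjTranspose_submatrix_one_mul_mul {S S' : Type} [Fintype S] [DecidableEq S]
    (f : S' → S) (M : Matrix S S ℂ) :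
    ((1 : Matrix S S ℂ).submatrix id f)ᴴ * M * (1 : Matrix S S ℂ).submatrix id f =
      M.submatrix f f := by
  ext x y
  simp [Matrix.mul_apply, one_apply]

/-- Each relabelling is a round with a single outcome, whose Kraus operator is a permutation matrix.
-/
theorem IsLOCCMeasurement.submatrix [DecidableEq X] {E : X → Matrix (C × D) (C × D) ℂ}
    (hE : IsLOCCMeasurement E) (eC : C' ≃ C) (eD : D' ≃ D) :
    IsLOCCMeasurement fun x => (E x).submatrix (Prod.map eC eD) (Prod.map eC eD) := by
  have h := IsLOCCMeasurement.right _ (isKraus_permutation eD) _ fun _ =>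
    IsLOCCMeasurement.left _ (isKraus_permutation eC) _ fun _ => hE
  convert h using 2 with x
  simp only [Fintype.sum_unique]
  have hl : (1 : Matrix C C ℂ).submatrix id eC ⊗ₖ (1 : Matrix D D ℂ) =
      (1 : Matrix (C × D) (C × D) ℂ).submatrix id (Prod.map eC id) := by
    rw [← one_kronecker_one]; rfl
  have hr : (1 : Matrix C' C' ℂ) ⊗ₖ (1 : Matrix D D ℂ).submatrix id eD =
      (1 : Matrix (C' × D) (C' × D) ℂ).submatrix id (Prod.map id eD) := by
    rw [← one_kronecker_one]; rfl
  rw [hl, hr, conjTranspose_submatrix_one_mul_mul, conjTranspose_submatrix_one_mul_mul]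
  rfl

theorem IsOneWayLOCCMeasurement.submatrix [Fintype X] {E : X → Matrix (C × D) (C × D) ℂ}
    (hE : IsOneWayLOCCMeasurement E) (eC : C' ≃ C) (eD : D' ≃ D) :
    IsOneWayLOCCMeasurement fun x => (E x).submatrix (Prod.map eC eD) (Prod.map eC eD) := by
  obtain ⟨I, _, P, N, hP, hN, rfl⟩ := hE
  have hsub : ∀ {S S' Y : Type} [Fintype S] [DecidableEq S] [Fintype S'] [DecidableEq S']
      [Fintype Y] (e : S' ≃ S) {M : Y → Matrix S S ℂ}, IsPOVM M →
      IsPOVM fun y => (M y).submatrix e e := by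
    intro S S' Y _ _ _ _ _ e M hM
    refine ⟨fun y => (hM.1 y).submatrix e, ?_⟩
    ext s t
    have h := congrFun (congrFun hM.2 (e s)) (e t)
    simpa [Matrix.sum_apply, one_apply] using h
  refine ⟨I, inferInstance, _, _, hsub eC hP, fun i => hsub eD (hN i), ?_⟩
  funext x
  ext y z
  simp [Matrix.sum_apply, kroneckerMap_apply]

section Tensor

variable {C₁' D₁' C₂' D₂' C₁'' D₁'' C₂'' D₂'' : Type}

/-- The tensor product of operators on `C₁ D₁` and `C₂ D₂`, as an operator on `(C₁ C₂) (D₁ D₂)`. -/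
def tensor {C₁ D₁ C₂ D₂ C₁' D₁' C₂' D₂' : Type} (F : Matrix (C₁ × D₁) (C₁' × D₁') ℂ)
    (G : Matrix (C₂ × D₂) (C₂' × D₂') ℂ) :
    Matrix ((C₁ × C₂) × D₁ × D₂) ((C₁' × C₂') × D₁' × D₂') ℂ :=
  (F ⊗ₖ G).submatrix (Equiv.prodProdProdComm C₁ C₂ D₁ D₂) (Equiv.prodProdProdComm C₁' C₂' D₁' D₂')

theorem tensor_mul {C₁ D₁ C₂ D₂ : Type} [Fintype C₁'] [Fintype D₁'] [Fintype C₂'] [Fintype D₂']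
    (F : Matrix (C₁ × D₁) (C₁' × D₁') ℂ) (G : Matrix (C₂ × D₂) (C₂' × D₂') ℂ)
    (F' : Matrix (C₁' × D₁') (C₁'' × D₁'') ℂ) (G' : Matrix (C₂' × D₂') (C₂'' × D₂'') ℂ) :
    tensor (F * F') (G * G') = tensor F G * tensor F' G' := by
  rw [tensor, tensor, tensor, mul_kronecker_mul, submatrix_mul_equiv]

theorem tensor_conjTranspose {C₁ D₁ C₂ D₂ : Type} (F : Matrix (C₁ × D₁) (C₁' × D₁') ℂ)
    (G : Matrix (C₂ × D₂) (C₂' × D₂') ℂ) : tensor Fᴴ Gᴴ = (tensor F G)ᴴ := by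
  rw [tensor, tensor, conjTranspose_submatrix, conjTranspose_kronecker]

theorem tensor_kronecker {C₁ D₁ C₂ D₂ : Type} (c₁ : Matrix C₁ C₁' ℂ) (d₁ : Matrix D₁ D₁' ℂ)
    (c₂ : Matrix C₂ C₂' ℂ) (d₂ : Matrix D₂ D₂' ℂ) :
    tensor (c₁ ⊗ₖ d₁) (c₂ ⊗ₖ d₂) = (c₁ ⊗ₖ c₂) ⊗ₖ (d₁ ⊗ₖ d₂) := by
  ext x y
  exact mul_mul_mul_comm _ _ _ _

theorem tensor_one_one :
    tensor (1 : Matrix (C₁ × D₁) (C₁ × D₁) ℂ) (1 : Matrix (C₂ × D₂) (C₂ × D₂) ℂ) = 1 := by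
  simp only [← one_kronecker_one, tensor_kronecker]

theorem tensor_sum_left {C₁ D₁ C₂ D₂ : Type} {I : Type} [Fintype I]
    (F : I → Matrix (C₁ × D₁) (C₁' × D₁') ℂ) (G : Matrix (C₂ × D₂) (C₂' × D₂') ℂ) :
    tensor (∑ i, F i) G = ∑ i, tensor (F i) G := by
  ext x y
  simp [tensor, Matrix.sum_apply, kroneckerMap_apply, Finset.sum_mul]

theorem tensor_sum_right {C₁ D₁ C₂ D₂ : Type} {I : Type} [Fintype I]
    (F : Matrix (C₁ × D₁) (C₁' × D₁') ℂ) (G : I → Matrix (C₂ × D₂) (C₂' × D₂') ℂ) :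
    tensor F (∑ i, G i) = ∑ i, tensor F (G i) := by
  ext x y
  simp [tensor, Matrix.sum_apply, kroneckerMap_apply, Finset.mul_sum]

theorem tensor_zero_left {C₁ D₁ C₂ D₂ : Type} (G : Matrix (C₂ × D₂) (C₂' × D₂') ℂ) :
    tensor (0 : Matrix (C₁ × D₁) (C₁' × D₁') ℂ) G = 0 := by
  ext x y
  simp [tensor]

theorem tensor_zero_right {C₁ D₁ C₂ D₂ : Type} (F : Matrix (C₁ × D₁) (C₁' × D₁') ℂ) :
    tensor F (0 : Matrix (C₂ × D₂) (C₂' × D₂') ℂ) = 0 := by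
  ext x y
  simp [tensor]

theorem tensor_conj_left {C₁ D₁ C₂ D₂ : Type} [Fintype C₁'] [Fintype D₁'] [Fintype C₂]
    [Fintype D₂] [DecidableEq C₂] [DecidableEq D₂] (L : Matrix (C₁' × D₁') (C₁ × D₁) ℂ)
    (F : Matrix (C₁' × D₁') (C₁' × D₁') ℂ) (G : Matrix (C₂ × D₂) (C₂ × D₂) ℂ) :
    tensor (Lᴴ * F * L) G =
      (tensor L (1 : Matrix (C₂ × D₂) (C₂ × D₂) ℂ))ᴴ * tensor F G *
        tensor L (1 : Matrix (C₂ × D₂) (C₂ × D₂) ℂ) := by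
  rw [← tensor_conjTranspose, ← tensor_mul, ← tensor_mul, conjTranspose_one, Matrix.one_mul,
    Matrix.mul_one]

theorem tensor_conj_right {C₁ D₁ C₂ D₂ : Type} [Fintype C₁] [Fintype D₁] [Fintype C₂']
    [Fintype D₂'] [DecidableEq C₁] [DecidableEq D₁] (L : Matrix (C₂' × D₂') (C₂ × D₂) ℂ)
    (F : Matrix (C₁ × D₁) (C₁ × D₁) ℂ) (G : Matrix (C₂' × D₂') (C₂' × D₂') ℂ) :
    tensor F (Lᴴ * G * L) =
      (tensor (1 : Matrix (C₁ × D₁) (C₁ × D₁) ℂ) L)ᴴ * tensor F G *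
        tensor (1 : Matrix (C₁ × D₁) (C₁ × D₁) ℂ) L := by
  rw [← tensor_conjTranspose, ← tensor_mul, ← tensor_mul, conjTranspose_one, Matrix.one_mul,
    Matrix.mul_one]

end Tensor

variable {Y : Type} [DecidableEq X] [DecidableEq Y]

/-- The second half of the sequential protocol below: the first measurement has ended with result
`x₀`, and the second is still to be run. -/
theorem IsLOCCMeasurement.tensor_announce {F : Y → Matrix (C₂ × D₂) (C₂ × D₂) ℂ}
    (hF : IsLOCCMeasurement F) (x₀ : X) : IsLOCCMeasurement fun z : X × Y =>
      tensor (if z.1 = x₀ then (1 : Matrix (C₁ × D₁) (C₁ × D₁) ℂ) else 0) (F z.2) := by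
  induction hF with
  | @announce C D _ _ _ _ y₀ =>
    convert IsLOCCMeasurement.announce (C := C₁ × C) (D := D₁ × D) (x₀, y₀) using 2 with z
    by_cases h₁ : z.1 = x₀ <;> by_cases h₂ : z.2 = y₀ <;>
      simp [h₁, h₂, Prod.ext_iff, tensor_one_one, tensor_zero_left, tensor_zero_right]
  | left K hK F _ ih =>
    have h := IsLOCCMeasurement.left _ (isKraus_one_kronecker (S₂ := C₁) hK) _ ih
    convert h using 2 with z
    rw [tensor_sum_right]
    refine Finset.sum_congr rfl fun i _ => ?_
    rw [tensor_conj_right]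
    simp only [← one_kronecker_one, tensor_kronecker]
  | right K hK F _ ih =>
    have h := IsLOCCMeasurement.right _ (isKraus_one_kronecker (S₂ := D₁) hK) _ ih
    convert h using 2 with z
    rw [tensor_sum_right]
    refine Finset.sum_congr rfl fun i _ => ?_
    rw [tensor_conj_right]
    simp only [← one_kronecker_one, tensor_kronecker]

/-- The protocol of `E` is run first, then that of `F`, hence the induction on `E` alone. -/
theorem IsLOCCMeasurement.tensor {E : X → Matrix (C₁ × D₁) (C₁ × D₁) ℂ}
    {F : Y → Matrix (C₂ × D₂) (C₂ × D₂) ℂ} (hE : IsLOCCMeasurement E)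
    (hF : IsLOCCMeasurement F) :
    IsLOCCMeasurement fun z : X × Y => KeyRepeater.tensor (E z.1) (F z.2) := by
  induction hE with
  | announce x₀ => exact hF.tensor_announce x₀
  | left K hK E _ ih =>
    have h := IsLOCCMeasurement.left _ (isKraus_kronecker_one (S₂ := C₂) hK) _ ih
    convert h using 2 with z
    rw [tensor_sum_left]
    refine Finset.sum_congr rfl fun i _ => ?_
    rw [tensor_conj_left]
    simp only [← one_kronecker_one, tensor_kronecker]
  | right K hK E _ ih =>
    have h := IsLOCCMeasurement.right _ (isKraus_kronecker_one (S₂ := D₂) hK) _ ih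
    convert h using 2 with z
    rw [tensor_sum_left]
    refine Finset.sum_congr rfl fun i _ => ?_
    rw [tensor_conj_left]
    simp only [← one_kronecker_one, tensor_kronecker]

theorem IsPOVM.kronecker [Fintype X] [Fintype Y] {S T : Type} [Fintype S] [DecidableEq S]
    [Fintype T] [DecidableEq T] {M : X → Matrix S S ℂ} {N : Y → Matrix T T ℂ} (hM : IsPOVM M)
    (hN : IsPOVM N) : IsPOVM fun z : X × Y => M z.1 ⊗ₖ N z.2 := by
  refine ⟨fun z => (hM.1 z.1).kronecker (hN.1 z.2), ?_⟩
  rw [← one_kronecker_one, ← hM.2, ← hN.2]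
  ext x y
  simp only [Matrix.sum_apply, kroneckerMap_apply, Finset.sum_mul_sum, Fintype.sum_prod_type]

/-- Both outcomes of Charlie travel in one message `(i, i')`, which keeps the communication one-way.
-/
theorem IsOneWayLOCCMeasurement.tensor [Fintype X] [Fintype Y]
    {E : X → Matrix (C₁ × D₁) (C₁ × D₁) ℂ} {F : Y → Matrix (C₂ × D₂) (C₂ × D₂) ℂ}
    (hE : IsOneWayLOCCMeasurement E) (hF : IsOneWayLOCCMeasurement F) :
    IsOneWayLOCCMeasurement fun z : X × Y => KeyRepeater.tensor (E z.1) (F z.2) := by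
  classical
  obtain ⟨I, _, P, N, hP, hN, rfl⟩ := hE
  obtain ⟨I', _, P', N', hP', hN', rfl⟩ := hF
  refine ⟨I × I', inferInstance, _, fun i z => N i.1 z.1 ⊗ₖ N' i.2 z.2, hP.kronecker hP',
    fun i => (hN i.1).kronecker (hN' i.2), ?_⟩
  funext z
  simp only [tensor_sum_left, tensor_sum_right, tensor_kronecker, Fintype.sum_prod_type]
  exact Finset.sum_comm

theorem IsLOCCMeasurement.isPOVM [Fintype X] {E : X → Matrix (C × D) (C × D) ℂ}
    (hE : IsLOCCMeasurement E) : IsPOVM E := by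
  have key : ∀ {S T I : Type} [Fintype S] [DecidableEq S] [Fintype T] [DecidableEq T]
      [Fintype I] {K : I → Matrix T S ℂ} {F : I → X → Matrix T T ℂ}, IsKraus K →
      (∀ i, IsPOVM (F i)) → IsPOVM fun x => ∑ i, (K i)ᴴ * F i x * K i := by
    intro S T I _ _ _ _ _ K F hK hF
    refine ⟨fun x => Matrix.posSemidef_sum _ fun i _ =>
      ((hF i).1 x).conjTranspose_mul_mul_same _, ?_⟩
    rw [Finset.sum_comm, ← hK]
    refine Finset.sum_congr rfl fun i _ => ?_
    rw [← Matrix.sum_mul, ← Matrix.mul_sum, (hF i).2, Matrix.mul_one]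
  induction hE with
  | announce x₀ =>
    refine ⟨fun x => ?_, by simp⟩
    by_cases h : x = x₀
    · simpa [h] using PosSemidef.one
    · simpa [h] using PosSemidef.zero
  | left K hK E _ ih => exact key (isKraus_kronecker_one hK) ih
  | right K hK E _ ih => exact key (isKraus_one_kronecker hK) ih

theorem IsOneWayLOCCMeasurement.isPOVM [Fintype X] {E : X → Matrix (C × D) (C × D) ℂ}
    (hE : IsOneWayLOCCMeasurement E) : IsPOVM E := by
  obtain ⟨I, _, P, N, hP, hN, rfl⟩ := hE
  refine ⟨fun x => Matrix.posSemidef_sum _ fun i _ => (hP.1 i).kronecker ((hN i).1 x), ?_⟩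
  rw [Finset.sum_comm, ← one_kronecker_one, ← hP.2]
  ext y z
  simp only [Matrix.sum_apply, kroneckerMap_apply, Finset.sum_mul]
  refine Finset.sum_congr rfl fun i _ => ?_
  rw [← Finset.mul_sum, ← Matrix.sum_apply, (hN i).2]

end Measurements

/-! ### Splitting the copies of a state into blocks. -/

section Copies

variable {A CA CB B : Type}

/-- Charlie's systems of `n + k` copies, split into the first `n` and the last `k` copies. -/
def charlieAppendEquiv (CA CB : Type) (n k : ℕ) :
    (Fin (n + k) → CA) × (Fin (n + k) → CB) ≃
      ((Fin n → CA) × (Fin n → CB)) × ((Fin k → CA) × (Fin k → CB)) :=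
  (Equiv.prodCongr (Fin.appendEquiv n k).symm (Fin.appendEquiv n k).symm).trans
    (Equiv.prodProdProdComm _ _ _ _)

/-- The systems of `n + k` copies, split into the first `n` and the last `k` copies. -/
def copiesEquiv (A CA CB B : Type) (n k : ℕ) :
    ((Fin (n + k) → CA) × (Fin (n + k) → CB)) × (Fin (n + k) → A) × (Fin (n + k) → B) ≃
      (((Fin n → CA) × (Fin n → CB)) × (Fin n → A) × (Fin n → B)) ×
        (((Fin k → CA) × (Fin k → CB)) × (Fin k → A) × (Fin k → B)) :=
  splitEquiv (charlieAppendEquiv CA CB n k) (Fin.appendEquiv n k).symm (Fin.appendEquiv n k).symm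

theorem copies_add (τ : Matrix ((CA × CB) × A × B) ((CA × CB) × A × B) ℂ) (n k : ℕ) :
    copies τ (n + k) = (copies τ n ⊗ₖ copies τ k).submatrix (copiesEquiv A CA CB B n k)
      (copiesEquiv A CA CB B n k) := by
  ext x y
  simp only [copies, of_apply, submatrix_apply, kroneckerMap_apply, Fin.prod_univ_add]
  rfl

variable [Fintype A] [Fintype CA] [Fintype CB] [Fintype B]

theorem isState_submatrix_equiv {S T : Type} [Fintype S] [Fintype T] {ρ : Matrix S S ℂ}
    (hρ : IsState ρ) (e : T ≃ S) : IsState (ρ.submatrix e e) := by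
  refine ⟨hρ.1.submatrix e, ?_⟩
  rw [← hρ.2, Matrix.trace, Matrix.trace]
  exact e.sum_comp fun s => ρ s s

theorem isState_kronecker {S T : Type} [Fintype S] [Fintype T] {ρ : Matrix S S ℂ}
    {σ : Matrix T T ℂ} (hρ : IsState ρ) (hσ : IsState σ) : IsState (ρ ⊗ₖ σ) :=
  ⟨hρ.1.kronecker hσ.1, by rw [trace_kronecker, hρ.2, hσ.2, mul_one]⟩

theorem isState_joint {ρ : Matrix (A × CA) (A × CA) ℂ} {ρ' : Matrix (CB × B) (CB × B) ℂ}
    (hρ : IsState ρ) (hρ' : IsState ρ') : IsState (joint ρ ρ') :=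
  isState_submatrix_equiv (isState_kronecker hρ hρ')
    (⟨fun x => ((x.2.1, x.1.1), (x.1.2, x.2.2)), fun y => ((y.1.2, y.2.1), (y.1.1, y.2.2)),
      fun _ => rfl, fun _ => rfl⟩ : (CA × CB) × A × B ≃ (A × CA) × (CB × B))

theorem isState_copies {τ : Matrix ((CA × CB) × A × B) ((CA × CB) × A × B) ℂ} (hτ : IsState τ) :
    ∀ n, IsState (copies τ n)
  | 0 => by
    have h : copies τ 0 = 1 := by
      ext x y
      rw [Subsingleton.elim x y]
      simp [copies]
    rw [h]
    exact ⟨PosSemidef.one, by simp⟩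
  | n + 1 => by
    rw [copies_add]
    refine isState_submatrix_equiv (isState_kronecker (isState_copies hτ n) ?_) _
    exact isState_submatrix_equiv hτ (⟨fun x => ((x.1.1 0, x.1.2 0), x.2.1 0, x.2.2 0), fun y =>
      ((fun _ => y.1.1, fun _ => y.1.2), fun _ => y.2.1, fun _ => y.2.2), fun x => by
        ext i <;> simp [Subsingleton.elim i 0], fun _ => rfl⟩ :
      ((Fin 1 → CA) × (Fin 1 → CB)) × (Fin 1 → A) × (Fin 1 → B) ≃ (CA × CB) × A × B) |> fun h => by
      convert h using 1
      ext x y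
      simp [copies]

end Copies

/-! ### Lower bounds on the relative entropy distance from block tests. -/

section Certificates

/-- Measurements of `C D` by LOCC: with one-way communication from `C` if `oneWay` is true. -/
def IsAllowed (oneWay : Bool) {X C D : Type} [Fintype X] [DecidableEq X] [Fintype C]
    [DecidableEq C] [Fintype D] [DecidableEq D] (E : X → Matrix (C × D) (C × D) ℂ) : Prop :=
  match oneWay with
  | true => IsOneWayLOCCMeasurement E
  | false => IsLOCCMeasurement E

variable {b : Bool} {X Y C A B C₁ A₁ B₁ C₂ A₂ B₂ : Type} [Fintype X] [DecidableEq X]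
  [Fintype Y] [DecidableEq Y] [Fintype C] [DecidableEq C] [Fintype A] [DecidableEq A] [Fintype B]
  [DecidableEq B] [Fintype C₁] [DecidableEq C₁] [Fintype A₁] [DecidableEq A₁] [Fintype B₁]
  [DecidableEq B₁] [Fintype C₂] [DecidableEq C₂] [Fintype A₂] [DecidableEq A₂] [Fintype B₂]
  [DecidableEq B₂]

theorem IsAllowed.isPOVM {E : X → Matrix (C × A × B) (C × A × B) ℂ} (hE : IsAllowed b E) :
    IsPOVM E := by
  cases b
  · exact IsLOCCMeasurement.isPOVM hE
  · exact IsOneWayLOCCMeasurement.isPOVM hE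

theorem isAllowed_trivial : IsAllowed b fun _ : Unit => (1 : Matrix (C × A × B) (C × A × B) ℂ) := by
  cases b
  · exact IsLOCCMeasurement.announce ()
  · refine ⟨Unit, inferInstance, fun _ => 1, fun _ _ => 1, ⟨fun _ => PosSemidef.one, by simp⟩,
      fun _ => ⟨fun _ => PosSemidef.one, by simp⟩, ?_⟩
    simp

theorem IsAllowed.kronecker {E : X → Matrix (C₁ × A₁ × B₁) (C₁ × A₁ × B₁) ℂ}
    {F : Y → Matrix (C₂ × A₂ × B₂) (C₂ × A₂ × B₂) ℂ} (hE : IsAllowed b E) (hF : IsAllowed b F)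
    (eC : C ≃ C₁ × C₂) (eA : A ≃ A₁ × A₂) (eB : B ≃ B₁ × B₂) :
    IsAllowed b fun z : X × Y => (E z.1 ⊗ₖ F z.2).submatrix (splitEquiv eC eA eB)
      (splitEquiv eC eA eB) := by
  let eD : A × B ≃ (A₁ × B₁) × (A₂ × B₂) :=
    (Equiv.prodCongr eA eB).trans (Equiv.prodProdProdComm _ _ _ _)
  cases b
  · exact (IsLOCCMeasurement.tensor hE hF).submatrix eC eD
  · exact (IsOneWayLOCCMeasurement.tensor hE hF).submatrix eC eD

theorem outcomeDist_nonneg {S : Type} [Fintype S] [DecidableEq S] {E : X → Matrix S S ℂ}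
    (hE : IsPOVM E) {ρ : Matrix S S ℂ} (hρ : ρ.PosSemidef) (x : X) : 0 ≤ outcomeDist E ρ x :=
  (Complex.le_def.mp (trace_mul_nonneg (hE.1 x) hρ)).1

theorem sum_outcomeDist {S : Type} [Fintype S] [DecidableEq S] {E : X → Matrix S S ℂ}
    (hE : IsPOVM E) {ρ : Matrix S S ℂ} (hρ : IsState ρ) : ∑ x, outcomeDist E ρ x = 1 := by
  simp only [outcomeDist]
  rw [← Complex.re_sum, ← Matrix.trace_sum, ← Matrix.sum_mul, hE.2, Matrix.one_mul, hρ.2,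
    Complex.one_re]

theorem outcomeDist_kronecker {S S₁ S₂ : Type} [Fintype S] [Fintype S₁] [DecidableEq S₁]
    [Fintype S₂] [DecidableEq S₂] {E : X → Matrix S₁ S₁ ℂ} {F : Y → Matrix S₂ S₂ ℂ}
    (hE : IsPOVM E) {ρ : Matrix S₁ S₁ ℂ}
    {σ : Matrix S₂ S₂ ℂ} (hρ : IsState ρ) (e : S ≃ S₁ × S₂) (z : X × Y) :
    outcomeDist (fun z : X × Y => (E z.1 ⊗ₖ F z.2).submatrix e e) ((ρ ⊗ₖ σ).submatrix e e) z =
      outcomeDist E ρ z.1 * outcomeDist F σ z.2 := by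
  have him := (Complex.le_def.mp (trace_mul_nonneg (hE.1 z.1) hρ.1)).2
  have htr : ((E z.1 ⊗ₖ F z.2 * ρ ⊗ₖ σ).submatrix e e).trace = (E z.1 ⊗ₖ F z.2 * ρ ⊗ₖ σ).trace :=
    e.sum_comp fun s => (E z.1 ⊗ₖ F z.2 * ρ ⊗ₖ σ) s s
  rw [outcomeDist, submatrix_mul_equiv, htr, ← mul_kronecker_mul, trace_kronecker, Complex.mul_re,
    ← him, Complex.zero_im, zero_mul, sub_zero]
  rfl

theorem sum_mul_logb_div_prod {p w : X → ℝ} {p' w' : Y → ℝ} (hw : ∀ x, 0 < w x)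
    (hw' : ∀ y, 0 < w' y) (hp : ∑ x, p x = 1) (hp' : ∑ y, p' y = 1) :
    ∑ z : X × Y, p z.1 * p' z.2 * Real.logb 2 (p z.1 * p' z.2 / (w z.1 * w' z.2)) =
      ∑ x, p x * Real.logb 2 (p x / w x) + ∑ y, p' y * Real.logb 2 (p' y / w' y) := by
  have h : ∀ x y, p x * p' y * Real.logb 2 (p x * p' y / (w x * w' y)) =
      p x * Real.logb 2 (p x / w x) * p' y + p x * (p' y * Real.logb 2 (p' y / w' y)) := by
    intro x y
    by_cases hx : p x = 0
    · simp [hx]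
    by_cases hy : p' y = 0
    · simp [hy]
    rw [mul_div_mul_comm, Real.logb_mul (div_ne_zero hx (hw x).ne') (div_ne_zero hy (hw' y).ne')]
    ring
  simp only [Fintype.sum_prod_type, h, Finset.sum_add_distrib, ← Finset.mul_sum, ← Finset.sum_mul,
    hp, hp', mul_one, one_mul]

theorem posSemidef_of_mem_SEP {A CA CB B : Type} [Fintype A] [Fintype CA] [Fintype CB] [Fintype B]
    {σ : Matrix ((CA × CB) × A × B) ((CA × CB) × A × B) ℂ} (hσ : σ ∈ SEP A CA CB B) :
    σ.PosSemidef := by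
  refine convexHull_min (t := {σ | σ.PosSemidef}) ?_ ?_ hσ
  · rintro _ ⟨a, c, c', b, ha, hc, hc', hb, rfl⟩
    exact (hc.1.kronecker hc'.1).kronecker (ha.1.kronecker hb.1)
  · intro x hx y hy s t hs ht _
    exact (PosSemidef.smul hx hs).add (PosSemidef.smul hy ht)

theorem SepBound.re_trace_mul_le {A CA CB B : Type} [Fintype A] [Fintype CA] [Fintype CB]
    [Fintype B] {F : Matrix ((CA × CB) × A × B) ((CA × CB) × A × B) ℂ} {r : ℝ}
    (hF : SepBound F r) {σ : Matrix ((CA × CB) × A × B) ((CA × CB) × A × B) ℂ}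
    (hσ : σ ∈ SEP A CA CB B) : (F * σ).trace.re ≤ r := by
  refine convexHull_min (t := {σ | (F * σ).trace.re ≤ r}) ?_ ?_ hσ
  · rintro _ ⟨a, c, c', b, ha, hc, hc', hb, rfl⟩
    have h := hF _ _ _ (hc.1.kronecker hc'.1) ha.1 hb.1
    rw [trace_kronecker, hc.2, hc'.2, ha.2, hb.2] at h
    simpa using h
  · intro x hx y hy s t hs ht hst
    simp only [Set.mem_ofPred_eq, Matrix.mul_add, Matrix.mul_smul, Matrix.trace_add,
      Matrix.trace_smul, Complex.add_re, Complex.real_smul, Complex.re_ofReal_mul] at hx hy ⊢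
    calc s * (F * x).trace.re + t * (F * y).trace.re ≤ s * r + t * r := by gcongr
      _ = r := by rw [← add_mul, hst, one_mul]

/-- Enlarging the second argument only lowers the logarithms; `w` need not be normalised. -/
theorem ofReal_le_relEntropy {p q w : X → ℝ} (hp : ∀ x, 0 ≤ p x) (hq : ∀ x, 0 ≤ q x)
    (hw : ∀ x, 0 < w x) (hqw : ∀ x, q x ≤ w x) :
    ENNReal.ofReal (∑ x, p x * Real.logb 2 (p x / w x)) ≤ relEntropy p q := by
  rw [relEntropy]
  split_ifs with h
  · refine ENNReal.ofReal_le_ofReal (Finset.sum_le_sum fun x _ => ?_)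
    rcases (hp x).eq_or_lt with hx | hx
    · simp [← hx]
    have hqx : 0 < q x := (hq x).lt_of_ne fun h0 => hx.ne' (h x h0.symm)
    gcongr
    · exact one_lt_two
    · exact div_pos hx (hw x)
    · exact hqw x
  · exact le_top

variable {CA CB : Type} [Fintype CA] [DecidableEq CA] [Fintype CB] [DecidableEq CB]

/-- An allowed measurement which certifies that the relative entropy distance of `ρ` from the
separable states is at least `L`: the probability of outcome `x` is at most `w x` in separable
states. -/
def Certificate (b : Bool) (ρ : Matrix (C × A × B) (C × A × B) ℂ) (L : ℝ) : Prop :=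
  ∃ (X : Type) (_ : Fintype X) (_ : DecidableEq X) (E : X → Matrix (C × A × B) (C × A × B) ℂ)
    (w : X → ℝ), IsAllowed b E ∧ (∀ x, 0 < w x) ∧ (∀ x, SepBound (E x) (w x)) ∧
      L ≤ ∑ x, outcomeDist E ρ x * Real.logb 2 (outcomeDist E ρ x / w x)

/-- An allowed test that `ρ` passes with probability at least `1 - ε`, and that reduces
the probabilities of other tests in separable states by a factor `2 ^ (-m)`. -/
def KeyTest (b : Bool) (ρ : Matrix (C × A × B) (C × A × B) ℂ) (ε : ℝ) (m : ℕ) : Prop :=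
  ∃ E : Bool → Matrix (C × A × B) (C × A × B) ℂ, IsAllowed b E ∧ 1 - ε ≤ outcomeDist E ρ true ∧
    ∀ {C₂ A₂ B₂ : Type} [Fintype C₂] [Fintype A₂] [Fintype B₂]
      (R : Matrix (C₂ × A₂ × B₂) (C₂ × A₂ × B₂) ℂ) (s : ℝ), 0 ≤ s → R.PosSemidef → SepBound R s →
      SepBoundWith R (E true) (s / 2 ^ m) ∧ SepBoundWith R (E false) s

/-- One measurement serves every `σ`, which is more than a bound on the infimum over `σ` of a
supremum over measurements requires. -/
theorem Certificate.exists_le_relEntropy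
    {τ : Matrix ((CA × CB) × A × B) ((CA × CB) × A × B) ℂ} (hτ : τ.PosSemidef) {L : ℝ}
    (h : Certificate b τ L) :
    ∃ (X : Type) (_ : Fintype X) (_ : DecidableEq X)
      (E : X → Matrix ((CA × CB) × A × B) ((CA × CB) × A × B) ℂ), IsAllowed b E ∧
        ∀ σ ∈ SEP A CA CB B,
          ENNReal.ofReal L ≤ relEntropy (outcomeDist E τ) (outcomeDist E σ) := by
  obtain ⟨X, _, _, E, w, hE, hw, hEw, hL⟩ := h
  refine ⟨X, _, _, E, hE, fun σ hσ => (ENNReal.ofReal_le_ofReal hL).trans ?_⟩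
  exact ofReal_le_relEntropy (outcomeDist_nonneg hE.isPOVM hτ)
    (outcomeDist_nonneg hE.isPOVM (posSemidef_of_mem_SEP hσ)) hw
    fun x => (hEw x).re_trace_mul_le hσ

theorem Certificate.le_loccDist {τ : Matrix ((CA × CB) × A × B) ((CA × CB) × A × B) ℂ}
    (hτ : τ.PosSemidef) {L : ℝ} (h : Certificate false τ L) : ENNReal.ofReal L ≤ loccDist τ := by
  obtain ⟨X, hX, hX', E, hE, hL⟩ := h.exists_le_relEntropy hτ
  exact le_iInf₂ fun σ hσ => le_iSup_of_le X <| le_iSup_of_le hX <| le_iSup_of_le hX' <|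
    le_iSup_of_le E <| le_iSup_of_le hE (hL σ hσ)

theorem Certificate.le_loccDistOneWay {τ : Matrix ((CA × CB) × A × B) ((CA × CB) × A × B) ℂ}
    (hτ : τ.PosSemidef) {L : ℝ} (h : Certificate true τ L) :
    ENNReal.ofReal L ≤ loccDistOneWay τ := by
  obtain ⟨X, hX, hX', E, hE, hL⟩ := h.exists_le_relEntropy hτ
  exact le_iInf₂ fun σ hσ => le_iSup_of_le X <| le_iSup_of_le hX <|
    le_iSup_of_le E <| le_iSup_of_le hE (hL σ hσ)

/-- The trivial measurement, used on the copies that do not fill a block. -/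
theorem certificate_zero {ρ : Matrix (C × A × B) (C × A × B) ℂ} (hρ : IsState ρ) :
    Certificate b ρ 0 := by
  refine ⟨Unit, _, _, _, fun _ => 1, isAllowed_trivial, fun _ => one_pos,
    fun _ c a b hc ha hb => ?_, ?_⟩
  · have him : ∀ {S : Type} [Fintype S] {M : Matrix S S ℂ}, M.PosSemidef → M.trace.im = 0 :=
      fun hM => (Complex.le_def.mp hM.trace_nonneg).2.symm
    rw [Matrix.one_mul, trace_kronecker, trace_kronecker, Complex.mul_re, Complex.mul_re, him hc,
      him ha]
    simp
  · simp [outcomeDist, hρ.2]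

/-- The right side is `p m` minus the binary entropy of `p`, which is at most one bit. -/
theorem mul_sub_one_le_of_one_sub_le {p ε : ℝ} {m : ℕ} (hp : 1 - ε ≤ p) (hp0 : 0 ≤ p) :
    (1 - ε) * m - 1 ≤ p * Real.logb 2 (p / (1 / 2 ^ m)) + (1 - p) * Real.logb 2 ((1 - p) / 1) := by
  have hlog : 0 < Real.log 2 := Real.log_pos one_lt_two
  have hent : -1 ≤ p * Real.logb 2 p + (1 - p) * Real.logb 2 (1 - p) := by
    have h := Real.binEntropy_le_log_two (p := p)
    rw [Real.binEntropy_eq_negMulLog_add_negMulLog_one_sub, Real.negMulLog, Real.negMulLog] at h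
    rw [Real.logb, Real.logb, ← mul_div_assoc, ← mul_div_assoc, ← add_div, le_div_iff₀ hlog]
    linarith
  have hm : p * Real.logb 2 (p / (1 / 2 ^ m)) = p * Real.logb 2 p + p * m := by
    rcases hp0.eq_or_lt with h0 | h0
    · simp [← h0]
    · rw [div_div_eq_mul_div, div_one, Real.logb_mul h0.ne' (by positivity), Real.logb_pow,
        Real.logb_self_eq_one one_lt_two]
      ring
  rw [hm, div_one]
  have hpm : (1 - ε) * m ≤ p * m := by gcongr
  linarith

/-- The weights multiply because the key test scales the bound of any `R`, in particular of each `F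
y`, even on states correlated between the blocks. The outcome probabilities multiply since the
measured state is a product, so the logarithmic sums add. -/
theorem Certificate.kronecker {ρ : Matrix (C₁ × A₁ × B₁) (C₁ × A₁ × B₁) ℂ}
    {σ : Matrix (C₂ × A₂ × B₂) (C₂ × A₂ × B₂) ℂ} (hρ : IsState ρ) (hσ : IsState σ)
    (eC : C ≃ C₁ × C₂) (eA : A ≃ A₁ × A₂) (eB : B ≃ B₁ × B₂) {ε L : ℝ} {m : ℕ}
    (h₁ : KeyTest b ρ ε m) (h₂ : Certificate b σ L) :
    Certificate b ((ρ ⊗ₖ σ).submatrix (splitEquiv eC eA eB) (splitEquiv eC eA eB))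
      ((1 - ε) * m - 1 + L) := by
  obtain ⟨E, hE, hp, hER⟩ := h₁
  obtain ⟨X, _, _, F, w, hF, hw, hFw, hL⟩ := h₂
  -- Failing the test carries no information about separable states, so its weight is the trivial
  -- bound `1`.
  let v : Bool → ℝ := fun x => if x then 1 / 2 ^ m else 1
  have hv : ∀ x, 0 < v x := by intro x; cases x <;> simp [v]
  refine ⟨Bool × X, _, _, _, fun z => v z.1 * w z.2, hE.kronecker hF eC eA eB,
    fun z => mul_pos (hv _) (hw _), fun z => SepBoundWith.sepBound eC eA eB ?_, ?_⟩
  · obtain ⟨ht, hf⟩ := hER (F z.2) (w z.2) (hw z.2).le (hF.isPOVM.1 z.2) (hFw z.2)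
    obtain ⟨x, y⟩ := z
    cases x
    · simpa [v] using hf
    · simpa [v, div_eq_inv_mul] using ht
  · simp only [outcomeDist_kronecker hE.isPOVM hρ]
    rw [sum_mul_logb_div_prod hv hw (sum_outcomeDist hE.isPOVM hρ) (sum_outcomeDist hF.isPOVM hσ)]
    refine add_le_add ?_ hL
    have hsum := sum_outcomeDist hE.isPOVM hρ
    rw [Fintype.sum_bool] at hsum ⊢
    have hf : outcomeDist E ρ false = 1 - outcomeDist E ρ true := by linarith
    rw [hf]
    exact mul_sub_one_le_of_one_sub_le hp (outcomeDist_nonneg hE.isPOVM hρ.1 true)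

end Certificates

/-! ### From key protocols to the asymptotic inequality. -/

section Rates

variable {A CA CB B : Type} [Fintype A] [DecidableEq A] [Fintype CA] [DecidableEq CA]
  [Fintype CB] [DecidableEq CB] [Fintype B] [DecidableEq B]

theorem Implements.keyTest {b : Bool} {C A B C' A' B' : Type} [Fintype C] [DecidableEq C]
    [Fintype A] [DecidableEq A] [Fintype B] [DecidableEq B] [Fintype C'] [DecidableEq C']
    [Fintype A'] [DecidableEq A'] [Fintype B'] [DecidableEq B'] {m : ℕ} {ε : ℝ}
    {Λ : Matrix (C × A × B) (C × A × B) ℂ →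
      Matrix (C' × (Fin (2 ^ m) × A') × (Fin (2 ^ m) × B'))
        (C' × (Fin (2 ^ m) × A') × (Fin (2 ^ m) × B')) ℂ}
    (hΛ : ∀ P : Bool → Matrix ((Fin (2 ^ m) × A') × (Fin (2 ^ m) × B'))
      ((Fin (2 ^ m) × A') × (Fin (2 ^ m) × B')) ℂ, IsKraus P →
        ∃ E, IsAllowed b E ∧ Implements (fun x => (P x)ᴴ * P x) Λ E)
    {γ : Matrix ((Fin (2 ^ m) × A') × (Fin (2 ^ m) × B'))
      ((Fin (2 ^ m) × A') × (Fin (2 ^ m) × B')) ℂ} (hγ : IsPrivateState m γ)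
    {ρ : Matrix (C × A × B) (C × A × B) ℂ} (hε : traceNorm (traceFst (Λ ρ) - γ) ≤ ε) :
    KeyTest b ρ ε m := by
  obtain ⟨U, hU, hUγ⟩ := hγ.exists_test
  set T := privacyTest U
  have hT : Tᴴ * T = T := by rw [conjTranspose_privacyTest, privacyTest_mul_self hU]
  have hT' : (1 - T)ᴴ * (1 - T) = 1 - T := by
    rw [conjTranspose_sub, conjTranspose_one, conjTranspose_privacyTest, Matrix.sub_mul,
      Matrix.one_mul, Matrix.mul_sub, Matrix.mul_one, privacyTest_mul_self hU, sub_self, sub_zero]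
  -- Both operators are projections, hence their own Kraus operators.
  let P := fun x : Bool => if x then T else 1 - T
  have hP : IsKraus P := by
    rw [IsKraus, Fintype.sum_bool]
    change Tᴴ * T + (1 - T)ᴴ * (1 - T) = 1
    rw [hT, hT', add_sub_cancel]
  obtain ⟨E, hE, htr, hsep⟩ := hΛ P hP
  refine ⟨E, hE, ?_, fun R s hs hR hRs => ⟨hsep R true _ ?_, hsep R false _ ?_⟩⟩
  · rw [outcomeDist, htr]
    change 1 - ε ≤ (Tᴴ * T * traceFst (Λ ρ)).trace.re
    rw [hT]
    have h := (abs_le.mp ((abs_re_trace_mul_le_traceNorm (conjTranspose_privacyTest U)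
      (privacyTest_mul_self hU) (traceFst (Λ ρ) - γ)).trans hε)).1
    rw [Matrix.mul_sub, Matrix.trace_sub, Complex.sub_re, hUγ, Complex.one_re] at h
    linarith
  · change SepBoundWith R (1 ⊗ₖ (Tᴴ * T)) _
    rw [hT]
    exact hRs.sepBoundWith_privacyTest hs hR hU
  · change SepBoundWith R (1 ⊗ₖ ((1 - T)ᴴ * (1 - T))) _
    rw [hT']
    exact hRs.sepBoundWith_one_sub_privacyTest hR U

theorem YieldsKey.keyTest {τ : Matrix ((CA × CB) × A × B) ((CA × CB) × A × B) ℂ} {ε : ℝ} {m : ℕ}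
    (h : YieldsKey τ ε m) : KeyTest false τ ε m := by
  obtain ⟨C', A', B', _, _, _, _, _, _, Λ, γ, hΛ, hγ, hε⟩ := h
  exact Implements.keyTest (fun P hP => hΛ.exists_measurement hP) hγ hε

theorem YieldsKeyOneWay.keyTest {τ : Matrix ((CA × CB) × A × B) ((CA × CB) × A × B) ℂ} {ε : ℝ}
    {m : ℕ} (h : YieldsKeyOneWay τ ε m) : KeyTest true τ ε m := by
  obtain ⟨C', A', B', _, _, _, _, _, _, Λ, γ, hΛ, hγ, hε⟩ := h
  exact Implements.keyTest (fun P hP => hΛ.exists_measurement hP) hγ hε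

/-- Induction on the number of blocks: each step adds one block of `n` copies with its key test,
starting from `r` untested copies. -/
theorem KeyTest.certificate_copies {b : Bool}
    {τ : Matrix ((CA × CB) × A × B) ((CA × CB) × A × B) ℂ} (hτ : IsState τ) {ε : ℝ} {n m : ℕ}
    (h : KeyTest b (copies τ n) ε m) (r : ℕ) :
    ∀ q : ℕ, Certificate b (copies τ (n * q + r)) (q * ((1 - ε) * m - 1))
  | 0 => by simpa using certificate_zero (isState_copies hτ _)
  | q + 1 => by
    have hN : n * (q + 1) + r = n + (n * q + r) := by ring
    have hL : ((q + 1 : ℕ) : ℝ) * ((1 - ε) * m - 1) =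
        (1 - ε) * m - 1 + q * ((1 - ε) * m - 1) := by push_cast; ring
    rw [hN, hL, copies_add]
    exact Certificate.kronecker (isState_copies hτ _) (isState_copies hτ _) _ _ _ h
      (certificate_copies hτ h r q)

/-- Every `N` is `n q + r` with `q = N / n` rounded down; rounding costs at most `a / N`, which
vanishes in the limit. -/
theorem ofReal_div_le_liminf {D : ℕ → ℝ≥0∞} {n : ℕ} (hn : n ≠ 0) {a : ℝ}
    (h : ∀ q r : ℕ, ENNReal.ofReal (q * a) ≤ D (n * q + r)) :
    ENNReal.ofReal (a / n) ≤ liminf (fun N : ℕ => D N / (N : ℝ≥0∞)) atTop := by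
  -- For `a ≤ 0` the left side is truncated to zero; the estimate of `q * a` below needs `a > 0`.
  rcases le_or_gt a 0 with ha | ha
  · rw [ENNReal.ofReal_of_nonpos (div_nonpos_of_nonpos_of_nonneg ha n.cast_nonneg)]
    exact zero_le
  have hn' : (0 : ℝ) < n := by exact_mod_cast Nat.pos_of_ne_zero hn
  have hlim : Tendsto (fun N : ℕ => ENNReal.ofReal (a / n - a / N)) atTop
      (nhds (ENNReal.ofReal (a / n))) := by
    refine ENNReal.tendsto_ofReal ?_
    simpa using tendsto_const_nhds.sub (tendsto_const_div_atTop_nhds_zero_nat a)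
  rw [← hlim.liminf_eq]
  refine liminf_le_liminf ?_
  filter_upwards [eventually_ge_atTop 1] with N hN
  have hN' : (0 : ℝ) < N := by exact_mod_cast hN
  rw [ENNReal.le_div_iff_mul_le (Or.inl (Nat.cast_ne_zero.mpr (by lia)))
    (Or.inl (ENNReal.natCast_ne_top N)), ← ENNReal.ofReal_natCast,
    ← ENNReal.ofReal_mul' hN'.le]
  refine le_trans (ENNReal.ofReal_le_ofReal ?_) ((h (N / n) (N % n)).trans (by rw [Nat.div_add_mod]))
  have hq : (N : ℝ) / n ≤ ((N / n : ℕ) : ℝ) + 1 := by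
    rw [div_le_iff₀ hn']
    exact_mod_cast (Nat.lt_div_mul_add (Nat.pos_of_ne_zero hn)).le.trans (by
      rw [add_mul, one_mul])
  calc (a / n - a / N) * N = (N / n - 1) * a := by field_simp
    _ ≤ ((N / n : ℕ) : ℝ) * a := by
      gcongr
      linarith

theorem iInf_limsup_le_liminf {D : ℕ → ℝ≥0∞} {Y : ℕ → ℝ → ℕ → Prop}
    (h : ∀ n ε m, Y n ε m → ∀ q r : ℕ,
      ENNReal.ofReal (q * ((1 - ε) * m - 1)) ≤ D (n * q + r)) :
    ⨅ (ε : ℝ) (_ : 0 < ε), limsup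
      (fun n : ℕ => ⨆ (m : ℕ) (_ : Y n ε m), (m : ℝ≥0∞) / (n : ℝ≥0∞)) atTop ≤
    liminf (fun n : ℕ => D n / (n : ℝ≥0∞)) atTop := by
  set d := liminf (fun n : ℕ => D n / (n : ℝ≥0∞)) atTop
  have hε : ∀ ε : ℝ, 0 < ε → ε < 1 → limsup
      (fun n : ℕ => ⨆ (m : ℕ) (_ : Y n ε m), (m : ℝ≥0∞) / (n : ℝ≥0∞)) atTop ≤
        ENNReal.ofReal (1 - ε)⁻¹ * d := by
    intro ε hε0 hε1
    have hε1' : 0 < 1 - ε := by linarith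
    have hlim : Tendsto (fun n : ℕ => ENNReal.ofReal (1 - ε)⁻¹ * (d + ENNReal.ofReal (1 / n))) atTop
        (nhds (ENNReal.ofReal (1 - ε)⁻¹ * d)) := by
      refine ENNReal.Tendsto.const_mul ?_ (Or.inr ENNReal.ofReal_ne_top)
      simpa using (tendsto_const_nhds (x := d)).add
        (ENNReal.tendsto_ofReal (tendsto_const_div_atTop_nhds_zero_nat (1 : ℝ)))
    rw [← hlim.limsup_eq]
    refine limsup_le_limsup ?_
    filter_upwards [eventually_ge_atTop 1] with n hn
    refine iSup₂_le fun m hm => ?_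
    have hn' : (0 : ℝ) < n := by exact_mod_cast hn
    have hd := ofReal_div_le_liminf (by lia) (h n ε m hm)
    -- The bit lost to the binary entropy is added back as `1 / n`, which disappears as `n → ∞`.
    calc (m : ℝ≥0∞) / n = ENNReal.ofReal ((1 - ε)⁻¹ * (((1 - ε) * m - 1) / n + 1 / n)) := by
          rw [← ENNReal.ofReal_natCast, ← ENNReal.ofReal_natCast,
            ← ENNReal.ofReal_div_of_pos hn']
          congr 1
          field_simp
          ring
      _ = ENNReal.ofReal (1 - ε)⁻¹ * ENNReal.ofReal (((1 - ε) * m - 1) / n + 1 / n) :=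
          ENNReal.ofReal_mul (inv_nonneg.mpr hε1'.le)
      _ ≤ _ := by
          gcongr
          exact ENNReal.ofReal_add_le.trans (by gcongr)
  -- The limit holds also for `d = ⊤`, since the factor tends to `1 ≠ 0`.
  have hlim : Tendsto (fun ε : ℝ => ENNReal.ofReal (1 - ε)⁻¹ * d) (nhdsWithin 0 (Set.Ioi 0))
      (nhds (ENNReal.ofReal (1 - 0)⁻¹ * d)) := by
    refine ENNReal.Tendsto.mul_const (ENNReal.tendsto_ofReal ?_) (Or.inl (by simp))
    have hc : ContinuousAt (fun ε : ℝ => (1 - ε)⁻¹) 0 := by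
      refine ContinuousAt.inv₀ (by fun_prop) (by simp)
    exact hc.tendsto.mono_left nhdsWithin_le_nhds
  simp only [sub_zero, inv_one, ENNReal.ofReal_one, one_mul] at hlim
  refine ge_of_tendsto hlim ?_
  filter_upwards [Ioo_mem_nhdsGT (zero_lt_one (α := ℝ))] with ε he
  exact (iInf₂_le ε he.1).trans (hε ε he.1 he.2)

end Rates

end KeyRepeater

open KeyRepeater in
theorem mainTheorem1 {A CA CB B : Type} [Fintype A] [DecidableEq A] [Fintype CA] [DecidableEq CA]
    [Fintype CB] [DecidableEq CB] [Fintype B] [DecidableEq B]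
    (ρ : Matrix (A × CA) (A × CA) ℂ) (ρ' : Matrix (CB × B) (CB × B) ℂ)
    (hρ : IsState ρ) (hρ' : IsState ρ') :
    keyRate (joint ρ ρ') ≤ regLoccDist (joint ρ ρ') ∧
      keyRateOneWay (joint ρ ρ') ≤ regLoccDistOneWay (joint ρ ρ') := by
  have hτ := isState_joint hρ hρ'
  refine ⟨iInf_limsup_le_liminf fun n ε m h q r => ?_, iInf_limsup_le_liminf fun n ε m h q r => ?_⟩
  · exact (h.keyTest.certificate_copies hτ r q).le_loccDist (isState_copies hτ _).1
  · exact (h.keyTest.certificate_copies hτ r q).le_loccDistOneWay (isState_copies hτ _).1
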